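/- There is an absolute constant $C>0$ with the following property. Let $a,b\ge 0$ be real numbers and let $N,n$ be positive integers. Let $A=(a_{ij})$ be an $N\times n$ random matrix whose entries are independent real random variables with mean zero such that $$\mathbb{E}a_{ij}^2\le 1,\qquad |a_{ij}|\le a \text{ almost surely}\qquad\text{for all } i,j.$$ Let $B$ be a fixed (non-random) real $n\times N$ matrix with $\|B\|\le 1$ whose columns $B_1,\dots,B_N\in\mathbb{R}^n$ satisfy $\|B_i\|_2\le b$ for every $i$. Here $\|\cdot\|$ denotes the spectral norm (the $\ell_2\to\ell_2$ operator norm) of a matrix, and $\|\cdot\|_2$ the Euclidean norm. Then $\|BA\|$ is integrable and $$\mathbb{E}\|BA\|\le C\bigl(1+a\,b^{1/2}\log^{1/4}(2n)\bigr)\sqrt n .$$ -/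

import Mathlib

open MeasureTheory ProbabilityTheory

-- `‖B‖` for a real matrix `B` is the spectral (`ℓ₂ → ℓ₂` operator) norm.
open scoped Matrix.Norms.L2Operator

/-! The proof gives the stronger bound `C (1 + a min(b,1)) √n`; since `‖B‖ ≤ 1` forces columns of
norm at most one, `b` may be replaced by `min b 1`, and dividing `A` by `1 + a min(b,1)` reduces to
`a b ≤ 1`, where the claim is `E‖BA‖ ≤ C √n`.

Up to rounding, `‖BA‖` is at most `D`, the supremum of `‖BAv‖` over dyadic vectors with `‖v‖² ≤ 5`
(`dyadicNorm`). Expand `‖BAv‖²` over pairs of columns of `A`. The diagonal is `O(n)` in mean,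
because each `‖BA_j‖²` has mean at most `n` and variance at most `10n`
(`IsNoise.integral_normSq_sub_sq_le`). The off-diagonal part is decoupled by averaging over
splittings of the columns, then cut into levels by the smaller of the two coordinates.

At level `2⁻ᵏ`, freeze one group of columns. What remains is a maximum of linear forms in the other
group, with coefficients at most `2⁻ᵏ b D` and square sum at most `5D²`, over a family of
log-cardinality `O(4ᵏ (K-k+1))`, where `4ᴷ ≈ n`. A Bernstein-type bound gives `O(2ᵏ (K-k+1)) E D`
(`IsNoise.integral_sup'_inner_le`). Summing over `k` costs only `O(2ᴷ) = O(√n)`, so `(E D)² ≤ E D² ≤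
C n + C √n E D`, which forces `E D ≤ C √n`. -/

/-! ### Dyadic vectors and their number. -/

/-- The set `{0} ∪ {± 2⁻ˡ : l ≤ k}`. -/
noncomputable def dyadicSet (k : ℕ) : Finset ℝ :=
  insert 0 ((Finset.range (k + 1)).image (fun l => (1 / 2 : ℝ) ^ l) ∪
    (Finset.range (k + 1)).image (fun l => -(1 / 2 : ℝ) ^ l))

lemma mem_dyadicSet {k : ℕ} {t : ℝ} :
    t ∈ dyadicSet k ↔ t = 0 ∨ ∃ l ≤ k, |t| = (1 / 2 : ℝ) ^ l := by
  simp only [dyadicSet, Finset.mem_insert, Finset.mem_union, Finset.mem_image, Finset.mem_range,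
    Nat.lt_succ_iff]
  refine or_congr_right ?_
  constructor
  · rintro (⟨l, hl, rfl⟩ | ⟨l, hl, rfl⟩)
    · exact ⟨l, hl, abs_of_nonneg (by positivity)⟩
    · exact ⟨l, hl, by rw [abs_neg]; exact abs_of_nonneg (by positivity)⟩
  · rintro ⟨l, hl, h⟩
    rcases eq_or_eq_neg_of_abs_eq h with h | h
    · exact Or.inl ⟨l, hl, h.symm⟩
    · exact Or.inr ⟨l, hl, h.symm⟩

/-- Vectors with entries in `dyadicSet k` and squared Euclidean norm at most `5`. -/
noncomputable def dyadicBall (κ : Type*) [Fintype κ] (k : ℕ) : Finset (κ → ℝ) := by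
  classical
  exact (Fintype.piFinset fun _ : κ => dyadicSet k).filter fun v => ∑ j, v j ^ 2 ≤ 5

lemma mem_dyadicBall {κ : Type*} [Fintype κ] {k : ℕ} {v : κ → ℝ} :
    v ∈ dyadicBall κ k ↔ (∀ j, v j ∈ dyadicSet k) ∧ ∑ j, v j ^ 2 ≤ 5 := by
  simp [dyadicBall]

lemma zero_mem_dyadicBall {κ : Type*} [Fintype κ] (k : ℕ) : (0 : κ → ℝ) ∈ dyadicBall κ k := by
  rw [mem_dyadicBall]
  simp [mem_dyadicSet]

/-- Replacing some entries of a vector of the dyadic ball by zero. -/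
lemma dyadicBall_of_eq_or_zero {κ : Type*} [Fintype κ] {k l : ℕ} {v x : κ → ℝ}
    (hv : v ∈ dyadicBall κ k) (hx : ∀ j, x j = 0 ∨ (x j = v j ∧ x j ∈ dyadicSet l)) :
    x ∈ dyadicBall κ l := by
  rw [mem_dyadicBall] at hv ⊢
  constructor
  · intro j
    rcases hx j with h | h
    · rw [h, mem_dyadicSet]; exact Or.inl rfl
    · exact h.2
  · refine le_trans (Finset.sum_le_sum fun j _ => ?_) hv.2
    rcases hx j with h | h
    · rw [h, zero_pow two_ne_zero]; exact sq_nonneg _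
    · rw [h.1]

/-- With `i = k - l` the exponent is `-2(m+1)4ⁱ ≤ -2(m+1+i)`, and `exp (-2) ≤ 1/4` leaves a
geometric series dominated by the finest scale `l = k`. -/
lemma sum_exp_neg_dyadic_le (k m : ℕ) :
    ∑ l ∈ Finset.range (k + 1), Real.exp (-(2 * 4 ^ k * (m + 1) * ((1 / 2 : ℝ) ^ l) ^ 2)) ≤
      (1 / 4 : ℝ) ^ m := by
  have he : Real.exp (-2) ≤ 1 / 4 := by
    have h1 : (2 : ℝ) ≤ Real.exp 1 := by linarith [Real.add_one_le_exp (1 : ℝ)]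
    have h2 : (4 : ℝ) ≤ Real.exp 2 := by
      have : Real.exp 2 = Real.exp 1 * Real.exp 1 := by rw [← Real.exp_add]; norm_num
      rw [this]; nlinarith
    rw [Real.exp_neg, one_div]
    exact inv_anti₀ (by norm_num) h2
  have hterm : ∀ l ∈ Finset.range (k + 1),
      Real.exp (-(2 * 4 ^ k * (m + 1) * ((1 / 2 : ℝ) ^ l) ^ 2)) ≤
        (1 / 4 : ℝ) ^ (m + 1) * (1 / 4 : ℝ) ^ (k - l) := by
    intro l hl
    obtain ⟨i, rfl⟩ : ∃ i, k = l + i := Nat.exists_eq_add_of_le (by simpa [Nat.lt_succ_iff] using hl)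
    have h4 : (4 : ℝ) ^ (l + i) * ((1 / 2 : ℝ) ^ l) ^ 2 = 4 ^ i := by
      rw [pow_add, ← pow_mul, mul_comm l 2, pow_mul]
      norm_num
      field_simp
      rw [← mul_pow]
      norm_num
    have h4' : ((i : ℝ) + 1) ≤ 4 ^ i := by
      have := one_add_mul_le_pow (a := (3 : ℝ)) (by norm_num) i
      norm_num at this
      nlinarith [Nat.cast_nonneg (α := ℝ) i]
    have hexp : -(2 * 4 ^ (l + i) * ((m : ℝ) + 1) * ((1 / 2 : ℝ) ^ l) ^ 2) ≤
        ((m + 1 + i : ℕ) : ℝ) * (-2) := by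
      have : 2 * 4 ^ (l + i) * ((m : ℝ) + 1) * ((1 / 2 : ℝ) ^ l) ^ 2 = 2 * (m + 1) * 4 ^ i := by
        rw [← h4]; ring
      rw [this]
      push_cast
      nlinarith [Nat.cast_nonneg (α := ℝ) i, Nat.cast_nonneg (α := ℝ) m]
    calc _ ≤ Real.exp (((m + 1 + i : ℕ) : ℝ) * (-2)) := Real.exp_le_exp.2 hexp
      _ = Real.exp (-2) ^ (m + 1 + i) := Real.exp_nat_mul _ _
      _ ≤ (1 / 4) ^ (m + 1 + i) := by gcongr
      _ = _ := by rw [pow_add, Nat.add_sub_cancel_left]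
  have hgeom : ∀ r : ℕ, ∑ i ∈ Finset.range r, (1 / 4 : ℝ) ^ i ≤ 4 := by
    intro r
    have h : ∑ i ∈ Finset.range r, (1 / 4 : ℝ) ^ i = (4 / 3) * (1 - (1 / 4) ^ r) := by
      induction r with
      | zero => simp
      | succ r ih => rw [Finset.sum_range_succ, ih]; ring
    rw [h]
    nlinarith [pow_pos (show (0 : ℝ) < 1 / 4 by norm_num) r]
  calc _ ≤ ∑ l ∈ Finset.range (k + 1), (1 / 4 : ℝ) ^ (m + 1) * (1 / 4 : ℝ) ^ (k - l) :=
        Finset.sum_le_sum hterm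
    _ = (1 / 4 : ℝ) ^ (m + 1) * ∑ i ∈ Finset.range (k + 1), (1 / 4 : ℝ) ^ i := by
        rw [← Finset.mul_sum, Finset.sum_flip (fun i => (1 / 4 : ℝ) ^ i)]
    _ ≤ (1 / 4 : ℝ) ^ (m + 1) * 4 := by gcongr; exact hgeom _
    _ = _ := by rw [pow_succ]; ring

/-- An exponential Markov bound for counting: each vector of the ball has weight `exp (μ (5 - ‖v‖²))
≥ 1`, and the total weight over the full grid factors over coordinates. One coordinate contributes
at most `1 + 2·4⁻ᵐ`, so all of them together at most `exp (2·4ᵏ)`. -/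
lemma card_dyadicBall_le {κ : Type*} [Fintype κ] {k m : ℕ} (hκ : Fintype.card κ ≤ 4 ^ (k + m)) :
    ((dyadicBall κ k).card : ℝ) ≤ Real.exp (12 * 4 ^ k * (m + 1)) := by
  set μ : ℝ := 2 * 4 ^ k * (m + 1) with hμ
  have hμ0 : 0 ≤ μ := by positivity
  have hD : ∑ d ∈ dyadicSet k, Real.exp (-(μ * d ^ 2)) ≤ Real.exp (2 * (1 / 4 : ℝ) ^ m) := by
    have h1 : ∑ d ∈ dyadicSet k, Real.exp (-(μ * d ^ 2)) ≤ 1 + 2 * (1 / 4 : ℝ) ^ m := by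
      have hnn : ∀ d : ℝ, 0 ≤ Real.exp (-(μ * d ^ 2)) := fun d => (Real.exp_pos _).le
      have himg : ∀ f : ℕ → ℝ, ∑ d ∈ (Finset.range (k + 1)).image f, Real.exp (-(μ * d ^ 2)) ≤
          ∑ l ∈ Finset.range (k + 1), Real.exp (-(μ * f l ^ 2)) := fun f =>
        Finset.sum_image_le_of_nonneg fun d _ => hnn d
      have hunion : ∀ A B : Finset ℝ, ∑ d ∈ A ∪ B, Real.exp (-(μ * d ^ 2)) ≤
          ∑ d ∈ A, Real.exp (-(μ * d ^ 2)) + ∑ d ∈ B, Real.exp (-(μ * d ^ 2)) := fun A B => by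
        rw [← Finset.sum_union_inter]
        exact le_add_of_nonneg_right (Finset.sum_nonneg fun d _ => hnn d)
      have h2 := himg fun l => (1 / 2 : ℝ) ^ l
      have h3 := himg fun l => -(1 / 2 : ℝ) ^ l
      have hs := sum_exp_neg_dyadic_le k m
      rw [← hμ] at hs
      simp only [neg_sq] at h3
      unfold dyadicSet
      rw [Finset.insert_eq]
      refine (hunion _ _).trans ?_
      rw [Finset.sum_singleton]
      have h4 := hunion ((Finset.range (k + 1)).image fun l => (1 / 2 : ℝ) ^ l)
        ((Finset.range (k + 1)).image fun l => -(1 / 2 : ℝ) ^ l)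
      have h5 := h4.trans (add_le_add (h2.trans hs) (h3.trans hs))
      have h6 : Real.exp (-(μ * 0 ^ 2)) = 1 := by simp
      rw [h6]
      exact (add_le_add le_rfl h5).trans (by linarith)
    linarith [Real.add_one_le_exp (2 * (1 / 4 : ℝ) ^ m)]
  classical
  have hcard : ((dyadicBall κ k).card : ℝ) ≤
      ∑ v ∈ Fintype.piFinset (fun _ : κ => dyadicSet k), Real.exp (5 * μ) *
        ∏ j, Real.exp (-(μ * v j ^ 2)) := by
    calc ((dyadicBall κ k).card : ℝ) = ∑ v ∈ dyadicBall κ k, (1 : ℝ) := by simp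
      _ ≤ ∑ v ∈ dyadicBall κ k, Real.exp (5 * μ) * ∏ j, Real.exp (-(μ * v j ^ 2)) := by
          refine Finset.sum_le_sum fun v hv => ?_
          rw [← Real.exp_sum, ← Real.exp_add]
          refine Real.one_le_exp ?_
          rw [Finset.sum_neg_distrib, ← Finset.mul_sum]
          nlinarith [(mem_dyadicBall.1 hv).2]
      _ ≤ _ := by
          refine Finset.sum_le_sum_of_subset_of_nonneg ?_ fun v _ _ => by positivity
          unfold dyadicBall
          exact Finset.filter_subset _ _
  refine hcard.trans ?_
  rw [← Finset.mul_sum, ← Finset.prod_univ_sum (fun _ : κ => dyadicSet k)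
    (fun _ d => Real.exp (-(μ * d ^ 2)))]
  rw [Finset.prod_const, Finset.card_univ]
  calc _ ≤ Real.exp (5 * μ) * Real.exp (2 * (1 / 4 : ℝ) ^ m) ^ Fintype.card κ := by
        gcongr
    _ = Real.exp (5 * μ + Fintype.card κ * (2 * (1 / 4 : ℝ) ^ m)) := by
        rw [← Real.exp_nat_mul, ← Real.exp_add]
    _ ≤ _ := by
        refine Real.exp_le_exp.2 ?_
        have h2 : (Fintype.card κ : ℝ) * (1 / 4 : ℝ) ^ m ≤ 4 ^ k := by
          have : (Fintype.card κ : ℝ) ≤ 4 ^ (k + m) := by exact_mod_cast hκ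
          calc (Fintype.card κ : ℝ) * (1 / 4 : ℝ) ^ m ≤ 4 ^ (k + m) * (1 / 4 : ℝ) ^ m := by gcongr
            _ = 4 ^ k := by rw [pow_add, mul_assoc, ← mul_pow]; norm_num
        have h3 : (0 : ℝ) ≤ 4 ^ k * m := by positivity
        rw [hμ]
        nlinarith

/-! ### Rounding, splitting into levels and decoupling. -/

/-- Rounding up to a power of two, at the scale `2⁻ᴷ` at the least. -/
lemma exists_dyadic_ge {t : ℝ} (h1 : t ≤ 1) (K : ℕ) :
    ∃ l ≤ K, t ≤ (1 / 2 : ℝ) ^ l ∧ ((1 / 2 : ℝ) ^ l) ^ 2 ≤ 4 * t ^ 2 + (1 / 4) ^ K := by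
  have h : ∃ l ≤ K, t ≤ (1 / 2 : ℝ) ^ l ∧ ((1 / 2 : ℝ) ^ l ≤ 2 * t ∨ l = K) := by
    induction K with
    | zero => exact ⟨0, le_rfl, by simpa using h1, Or.inr rfl⟩
    | succ K ih =>
      obtain ⟨l, hl, hle, h | rfl⟩ := ih
      · exact ⟨l, by omega, hle, Or.inl h⟩
      · by_cases h : t ≤ (1 / 2 : ℝ) ^ (l + 1)
        · exact ⟨l + 1, le_rfl, h, Or.inr rfl⟩
        · refine ⟨l, by omega, hle, Or.inl ?_⟩
          rw [pow_succ] at h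
          linarith
  obtain ⟨l, hl, hle, h | rfl⟩ := h
  · refine ⟨l, hl, hle, ?_⟩
    have h3 : ((1 / 2 : ℝ) ^ l) ^ 2 ≤ (2 * t) ^ 2 := by gcongr
    have h4 : (0 : ℝ) ≤ (1 / 4) ^ K := by positivity
    nlinarith
  · refine ⟨l, le_rfl, hle, ?_⟩
    rw [← pow_mul, mul_comm l 2, pow_mul]
    norm_num
    positivity

lemma exists_dyadicBall_sum_ge {κ : Type*} [Fintype κ] {K : ℕ} (hκ : Fintype.card κ ≤ 4 ^ K)
    {v : κ → ℝ} (hv : ∑ j, v j ^ 2 ≤ 1) (w : κ → ℝ) :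
    ∃ x ∈ dyadicBall κ K, ∑ j, v j * w j ≤ ∑ j, x j * w j := by
  have hv1 : ∀ j, |v j| ≤ 1 := by
    intro j
    have : v j ^ 2 ≤ 1 :=
      (Finset.single_le_sum (fun j _ => sq_nonneg (v j)) (Finset.mem_univ j)).trans hv
    rwa [sq_le_one_iff_abs_le_one] at this
  choose l hlK hle hsq using fun j => exists_dyadic_ge (hv1 j) K
  -- Magnitudes come from rounding `|v j|` up, signs from `w j`, so every term of the sum can only
  -- grow. The squared norm is at most `4 + card κ / 4 ^ K ≤ 5`.
  refine ⟨fun j => if 0 ≤ w j then (1 / 2 : ℝ) ^ l j else -(1 / 2 : ℝ) ^ l j, ?_, ?_⟩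
  · rw [mem_dyadicBall]
    constructor
    · intro j
      rw [mem_dyadicSet]
      refine Or.inr ⟨l j, hlK j, ?_⟩
      split_ifs
      · exact abs_of_nonneg (by positivity)
      · rw [abs_neg]; exact abs_of_nonneg (by positivity)
    · have h1 : ∀ j, (if 0 ≤ w j then (1 / 2 : ℝ) ^ l j else -(1 / 2 : ℝ) ^ l j) ^ 2 ≤
          4 * v j ^ 2 + (1 / 4) ^ K := by
        intro j
        have := hsq j
        rw [sq_abs] at this
        split_ifs
        · exact this
        · rwa [neg_sq]
      refine (Finset.sum_le_sum fun j _ => h1 j).trans ?_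
      rw [Finset.sum_add_distrib, ← Finset.mul_sum, Finset.sum_const, nsmul_eq_mul,
        Finset.card_univ]
      have h2 : (Fintype.card κ : ℝ) * (1 / 4) ^ K ≤ 1 := by
        have : (Fintype.card κ : ℝ) ≤ 4 ^ K := by exact_mod_cast hκ
        calc (Fintype.card κ : ℝ) * (1 / 4) ^ K ≤ 4 ^ K * (1 / 4) ^ K := by gcongr
          _ = 1 := by rw [← mul_pow]; norm_num
      linarith
  · refine Finset.sum_le_sum fun j _ => ?_
    dsimp only
    split_ifs with h
    · exact mul_le_mul_of_nonneg_right ((le_abs_self _).trans (hle j)) h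
    · push Not at h
      exact mul_le_mul_of_nonpos_right (by linarith [neg_abs_le (v j), hle j]) h.le

/-- A product of two elements of the dyadic set, split according to the smaller factor. -/
lemma mul_eq_sum_levels {K : ℕ} {s t : ℝ} (hs : s ∈ dyadicSet K) (ht : t ∈ dyadicSet K) :
    s * t = ∑ k ∈ Finset.range (K + 1),
      ((if |s| = (1 / 2 : ℝ) ^ k then s else 0) * (if (1 / 2 : ℝ) ^ k ≤ |t| then t else 0) +
       (if (1 / 2 : ℝ) ^ k < |s| then s else 0) * (if |t| = (1 / 2 : ℝ) ^ k then t else 0)) := by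
  rcases mem_dyadicSet.1 hs with rfl | ⟨p, hp, hsp⟩
  · simp
  rcases mem_dyadicSet.1 ht with rfl | ⟨q, hq, htq⟩
  · simp
  have hinj : ∀ a b : ℕ, (1 / 2 : ℝ) ^ a = (1 / 2 : ℝ) ^ b ↔ a = b := fun a b =>
    pow_right_inj₀ (by norm_num) (by norm_num)
  have hlt : ∀ a b : ℕ, (1 / 2 : ℝ) ^ a < (1 / 2 : ℝ) ^ b ↔ b < a := fun a b =>
    pow_lt_pow_iff_right_of_lt_one₀ (by norm_num) (by norm_num)
  have hle : ∀ a b : ℕ, (1 / 2 : ℝ) ^ a ≤ (1 / 2 : ℝ) ^ b ↔ b ≤ a := fun a b =>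
    pow_le_pow_iff_right_of_lt_one₀ (by norm_num) (by norm_num)
  simp only [hsp, htq, hinj, hlt, hle]
  -- Only the level of the smaller factor survives. Ties go to the first summand, whose inequality
  -- is the non-strict one.
  rcases le_or_gt q p with h | h
  · rw [Finset.sum_eq_single p]
    · simp [h]
    · intro k _ hk
      by_cases hqk : q = k
      · subst hqk
        simp [not_lt.2 h, hk.symm]
      · simp [hqk, hk.symm]
    · intro hn
      exact absurd (Finset.mem_range.2 (Nat.lt_succ_of_le hp)) hn
  · rw [Finset.sum_eq_single q]
    · simp [h, h.ne]
    · intro k _ hk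
      by_cases hpk : p = k
      · subst hpk
        simp [not_le.2 h, hk.symm]
      · simp [hpk, hk.symm]
    · intro hn
      exact absurd (Finset.mem_range.2 (Nat.lt_succ_of_le hq)) hn

/-- The sum off the diagonal is four times the average of the sums over `S × Sᶜ`. -/
lemma sum_offDiag_eq_average {κ : Type*} [Fintype κ] [DecidableEq κ] (M : κ → κ → ℝ) :
    ∑ j, ∑ l, (if j = l then 0 else M j l) =
      4 / 2 ^ Fintype.card κ * ∑ S : Finset κ, ∑ j, ∑ l, (if j ∈ S ∧ l ∉ S then M j l else 0) := by
  -- A quarter of all subsets contain `j` and avoid `l`: the other elements are free.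
  have hcount : ∀ j l : κ, j ≠ l →
      4 * ((Finset.univ.filter fun S : Finset κ => j ∈ S ∧ l ∉ S).card) = 2 ^ Fintype.card κ := by
    intro j l hjl
    have h1 : (Finset.univ.filter fun S : Finset κ => j ∈ S ∧ l ∉ S).card =
        (Finset.powerset (Finset.univ \ {j, l})).card := by
      refine Finset.card_bij' (fun S _ => S.erase j) (fun S _ => insert j S) ?_ ?_ ?_ ?_
      · intro S hS
        simp only [Finset.mem_filter, Finset.mem_univ, true_and] at hS
        rw [Finset.mem_powerset]
        intro x hx
        simp only [Finset.mem_erase] at hx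
        simp only [Finset.mem_sdiff, Finset.mem_univ, true_and, Finset.mem_insert,
          Finset.mem_singleton]
        rintro (rfl | rfl)
        · exact hx.1 rfl
        · exact hS.2 hx.2
      · intro S hS
        rw [Finset.mem_powerset] at hS
        have : l ∉ S := fun h => by simpa using hS h
        simp [this, hjl.symm]
      · intro S hS
        simp only [Finset.mem_filter, Finset.mem_univ, true_and] at hS
        exact Finset.insert_erase hS.1
      · intro S hS
        rw [Finset.mem_powerset] at hS
        have : j ∉ S := fun h => by simpa using hS h
        exact Finset.erase_insert this
    have h2 : (Finset.univ \ {j, l} : Finset κ).card + 2 = Fintype.card κ := by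
      rw [← Finset.card_pair hjl, Finset.card_sdiff_add_card_eq_card (Finset.subset_univ _),
        Finset.card_univ]
    rw [h1, Finset.card_powerset, ← h2, pow_add]
    ring
  have hswap : ∑ S : Finset κ, ∑ j, ∑ l, (if j ∈ S ∧ l ∉ S then M j l else 0) =
      ∑ j, ∑ l, ∑ S : Finset κ, (if j ∈ S ∧ l ∉ S then M j l else 0) := by
    rw [Finset.sum_comm]
    exact Finset.sum_congr rfl fun j _ => Finset.sum_comm
  rw [hswap, Finset.mul_sum]
  refine Finset.sum_congr rfl fun j _ => ?_
  rw [Finset.mul_sum]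
  refine Finset.sum_congr rfl fun l _ => ?_
  rw [← Finset.sum_filter, Finset.sum_const, nsmul_eq_mul]
  by_cases hjl : j = l
  · subst hjl
    simp
  · have h := hcount j l hjl
    have h' : 4 * ((Finset.univ.filter fun S : Finset κ => j ∈ S ∧ l ∉ S).card : ℝ) =
        2 ^ Fintype.card κ := by exact_mod_cast h
    rw [if_neg hjl, ← h']
    have : ((Finset.univ.filter fun S : Finset κ => j ∈ S ∧ l ∉ S).card : ℝ) ≠ 0 := by
      intro h0
      rw [h0] at h'
      have h2 : (0 : ℝ) < 2 ^ Fintype.card κ := by positivity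
      linarith
    field_simp

/-! ### Conditioning and moment bounds for bounded independent noise. -/

/-- Set the coordinates outside `S` to zero. -/
def coordMask {σ : Type*} [DecidableEq σ] (S : Finset σ) (w : σ → ℝ) : σ → ℝ :=
  fun p => if p ∈ S then w p else 0

lemma continuous_coordMask {σ : Type*} [DecidableEq σ] (S : Finset σ) :
    Continuous (coordMask S) := by
  refine continuous_pi fun p => ?_
  unfold coordMask
  split_ifs
  · exact continuous_apply p
  · exact continuous_const

lemma abs_coordMask_le {σ : Type*} [DecidableEq σ] (S : Finset σ) (w : σ → ℝ) (p : σ) :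
    |coordMask S w p| ≤ |w p| := by
  unfold coordMask
  split_ifs
  · exact le_rfl
  · rw [abs_zero]; exact abs_nonneg _

section Bounded

variable {σ Ω : Type*} [Fintype σ] [MeasurableSpace Ω] {P : Measure Ω} [IsProbabilityMeasure P]

lemma integrable_continuous_comp {X : Ω → σ → ℝ} (hX : Measurable X) {a : ℝ}
    (hb : ∀ ω s, |X ω s| ≤ a) {F : (σ → ℝ) → ℝ} (hF : Continuous F) :
    Integrable (fun ω => F (X ω)) P := by
  have hc : IsCompact (Set.univ.pi fun _ : σ => Set.Icc (-a) a) :=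
    isCompact_univ_pi fun _ => isCompact_Icc
  obtain ⟨M, hM⟩ := hc.exists_bound_of_continuousOn hF.continuousOn
  refine Integrable.of_bound (hF.measurable.comp hX).aestronglyMeasurable M
    (Filter.Eventually.of_forall fun ω => hM _ fun s _ => ?_)
  exact abs_le.1 (hb ω s)

/-- Conditioning on `Y`: by independence the joint law is that of `(X z.1, Y z.2)` on `Ω × Ω`, and
Fubini applies. -/
lemma integral_le_of_indepFun {X Y : Ω → σ → ℝ} (hX : Measurable X) (hY : Measurable Y) {a : ℝ}
    (hbX : ∀ ω s, |X ω s| ≤ a) (hbY : ∀ ω s, |Y ω s| ≤ a) (hXY : IndepFun X Y P)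
    {F : (σ → ℝ) → (σ → ℝ) → ℝ} (hF : Continuous (Function.uncurry F)) {g : (σ → ℝ) → ℝ}
    (hg : Continuous g) (h : ∀ ω', ∫ ω, F (X ω) (Y ω') ∂P ≤ g (Y ω')) :
    ∫ ω, F (X ω) (Y ω) ∂P ≤ ∫ ω, g (Y ω) ∂P := by
  have hmap : P.map (fun ω => (X ω, Y ω)) = (P.prod P).map (Prod.map X Y) := by
    rw [hXY.map_prod_eq_prod_map_map hX.aemeasurable hY.aemeasurable,
      Measure.map_prod_map P P hX hY]
  have hint : Integrable (fun z : Ω × Ω => F (X z.1) (Y z.2)) (P.prod P) := by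
    have hc : IsCompact ((Set.univ.pi fun _ : σ => Set.Icc (-a) a) ×ˢ
        (Set.univ.pi fun _ : σ => Set.Icc (-a) a)) :=
      (isCompact_univ_pi fun _ => isCompact_Icc).prod (isCompact_univ_pi fun _ => isCompact_Icc)
    obtain ⟨M, hM⟩ := hc.exists_bound_of_continuousOn hF.continuousOn
    refine Integrable.of_bound
      (hF.measurable.comp (hX.prodMap hY)).aestronglyMeasurable M
      (Filter.Eventually.of_forall fun z => hM (X z.1, Y z.2) ⟨fun s _ => ?_, fun s _ => ?_⟩)
    · exact abs_le.1 (hbX z.1 s)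
    · exact abs_le.1 (hbY z.2 s)
  calc ∫ ω, F (X ω) (Y ω) ∂P = ∫ z, Function.uncurry F z ∂(P.map fun ω => (X ω, Y ω)) := by
        rw [integral_map (hX.prodMk hY).aemeasurable hF.measurable.aestronglyMeasurable]
        rfl
    _ = ∫ z, F (X z.1) (Y z.2) ∂(P.prod P) := by
        rw [hmap, integral_map (hX.prodMap hY).aemeasurable hF.measurable.aestronglyMeasurable]
        rfl
    _ = ∫ ω', ∫ ω, F (X ω) (Y ω') ∂P ∂P := integral_prod_symm _ hint
    _ ≤ _ := integral_mono hint.integral_prod_right (integrable_continuous_comp hY hbY hg) h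

omit [Fintype σ] [IsProbabilityMeasure P] in
lemma indepFun_coordMask [DecidableEq σ] {X : Ω → σ → ℝ} (hX : ∀ s, Measurable fun ω => X ω s)
    (hind : iIndepFun (fun s ω => X ω s) P) {S T : Finset σ} (hST : Disjoint S T) :
    IndepFun (fun ω => coordMask S (X ω)) (fun ω => coordMask T (X ω)) P := by
  have hm : ∀ U : Finset σ,
      Measurable fun (u : U → ℝ) (p : σ) => if h : p ∈ U then u ⟨p, h⟩ else 0 := by
    intro U
    refine measurable_pi_lambda _ fun p => ?_
    by_cases h : p ∈ U
    · simp only [h, dif_pos]; exact measurable_pi_apply _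
    · simp only [h, dif_neg, not_false_eq_true]; exact measurable_const
  have h := (hind.indepFun_finset S T hST hX).comp (hm S) (hm T)
  convert h using 1 <;> · funext ω p; simp [coordMask, Function.comp]

/-- Independent, centred, bounded random variables with variance at most one. -/
structure IsNoise (X : Ω → σ → ℝ) (a : ℝ) (P : Measure Ω) : Prop where
  measurable : ∀ s, Measurable fun ω => X ω s
  indep : iIndepFun (fun s ω => X ω s) P
  mean : ∀ s, ∫ ω, X ω s ∂P = 0
  sq_le : ∀ s, ∫ ω, X ω s ^ 2 ∂P ≤ 1
  bound : ∀ ω s, |X ω s| ≤ a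

lemma IsNoise.integrable {X : Ω → σ → ℝ} {a : ℝ} (hX : IsNoise X a P) {F : (σ → ℝ) → ℝ}
    (hF : Continuous F) : Integrable (fun ω => F (X ω)) P :=
  integrable_continuous_comp (measurable_pi_lambda _ hX.measurable) hX.bound hF

lemma IsNoise.integral_quadratic {X : Ω → σ → ℝ} {a : ℝ} (hX : IsNoise X a P) (s : σ)
    (c₀ c₁ c₂ : ℝ) : ∫ ω, (c₀ + c₁ * X ω s + c₂ * X ω s ^ 2) ∂P =
      c₀ + c₂ * ∫ ω, X ω s ^ 2 ∂P := by
  have i1 : Integrable (fun ω => c₁ * X ω s) P :=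
    hX.integrable (F := fun w => c₁ * w s) (by fun_prop)
  have i2 : Integrable (fun ω => c₂ * X ω s ^ 2) P :=
    hX.integrable (F := fun w => c₂ * w s ^ 2) (by fun_prop)
  have i3 : Integrable (fun ω => c₀ + c₁ * X ω s) P :=
    hX.integrable (F := fun w => c₀ + c₁ * w s) (by fun_prop)
  rw [integral_add i3 i2, integral_add (integrable_const _) i1, integral_const_mul,
    integral_const_mul, hX.mean s]
  simp

/-- Bernstein's argument: `exp x ≤ 1 + x + x²` for `|x| ≤ 1`, factor by factor. -/
lemma IsNoise.integral_exp_le {X : Ω → σ → ℝ} {a : ℝ} (hX : IsNoise X a P) {c : σ → ℝ}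
    (hc : ∀ s, a * |c s| ≤ 1) :
    ∫ ω, Real.exp (∑ s, c s * X ω s) ∂P ≤ Real.exp (∑ s, c s ^ 2) := by
  have hind : iIndepFun (fun s ω => c s * X ω s) P :=
    hX.indep.comp (fun s x => c s * x) fun s => measurable_const_mul (c s)
  have h := hind.mgf_sum (t := 1) (fun s => (hX.measurable s).const_mul (c s)) Finset.univ
  have h1 : mgf (∑ s, fun ω => c s * X ω s) P 1 = ∫ ω, Real.exp (∑ s, c s * X ω s) ∂P := by
    simp [mgf, Finset.sum_apply]
  rw [← h1, h, Real.exp_sum]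
  refine Finset.prod_le_prod (fun s _ => mgf_nonneg) fun s _ => ?_
  have hpt : ∀ ω, Real.exp (1 * (c s * X ω s)) ≤ 1 + c s * X ω s + c s ^ 2 * X ω s ^ 2 := by
    intro ω
    have hle : |c s * X ω s| ≤ 1 := by
      rw [abs_mul]
      calc |c s| * |X ω s| ≤ |c s| * a := by gcongr; exact hX.bound ω s
        _ ≤ 1 := by rw [mul_comm]; exact hc s
    have := (abs_le.1 (Real.abs_exp_sub_one_sub_id_le hle)).2
    rw [one_mul]
    nlinarith
  calc mgf (fun ω => c s * X ω s) P 1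
      ≤ ∫ ω, (1 + c s * X ω s + c s ^ 2 * X ω s ^ 2) ∂P :=
        integral_mono (hX.integrable (F := fun w => Real.exp (1 * (c s * w s))) (by fun_prop))
          (hX.integrable (F := fun w => 1 + c s * w s + c s ^ 2 * w s ^ 2) (by fun_prop)) hpt
    _ = 1 + c s ^ 2 * ∫ ω, X ω s ^ 2 ∂P := by
        exact hX.integral_quadratic s 1 (c s) (c s ^ 2)
    _ ≤ 1 + c s ^ 2 := by nlinarith [hX.sq_le s, sq_nonneg (c s)]
    _ ≤ Real.exp (c s ^ 2) := by linarith [Real.add_one_le_exp (c s ^ 2)]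

lemma IsNoise.integral_sup'_le {X : Ω → σ → ℝ} {a : ℝ} (hX : IsNoise X a P) {γ : Type*}
    {t : Finset γ} (ht : t.Nonempty) {c : γ → σ → ℝ} {R ℓ : ℝ}
    (hc : ∀ p ∈ t, ∀ s, a * |c p s| ≤ 1) (hR : ∀ p ∈ t, ∑ s, c p s ^ 2 ≤ R)
    (hcard : (t.card : ℝ) ≤ Real.exp ℓ) :
    ∫ ω, t.sup' ht (fun p => ∑ s, c p s * X ω s) ∂P ≤ ℓ + R := by
  -- The maximum is at most the logarithm of the sum of exponentials; that logarithm is replaced by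
  -- its tangent at `exp (ℓ + R)`.
  have hpt : ∀ ω, t.sup' ht (fun p => ∑ s, c p s * X ω s) ≤
      (ℓ + R - 1) + Real.exp (-(ℓ + R)) * ∑ p ∈ t, Real.exp (∑ s, c p s * X ω s) := by
    intro ω
    refine Finset.sup'_le ht _ fun p hp => ?_
    have h1 : Real.exp (∑ s, c p s * X ω s) ≤ ∑ p ∈ t, Real.exp (∑ s, c p s * X ω s) :=
      Finset.single_le_sum (f := fun p => Real.exp (∑ s, c p s * X ω s))
        (fun p _ => (Real.exp_pos _).le) hp
    have h2 := Real.add_one_le_exp (-(ℓ + R) + ∑ s, c p s * X ω s)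
    rw [Real.exp_add] at h2
    have h3 := mul_le_mul_of_nonneg_left h1 (Real.exp_pos (-(ℓ + R))).le
    linarith
  have iexp : ∀ p, Integrable (fun ω => Real.exp (∑ s, c p s * X ω s)) P := fun p =>
    hX.integrable (F := fun w => Real.exp (∑ s, c p s * w s)) (by fun_prop)
  have hsum : ∫ ω, ∑ p ∈ t, Real.exp (∑ s, c p s * X ω s) ∂P ≤ Real.exp (ℓ + R) := by
    rw [integral_finsetSum _ fun p _ => iexp p]
    calc ∑ p ∈ t, ∫ ω, Real.exp (∑ s, c p s * X ω s) ∂P ≤ ∑ p ∈ t, Real.exp R :=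
          Finset.sum_le_sum fun p hp =>
            (hX.integral_exp_le (hc p hp)).trans (Real.exp_le_exp.2 (hR p hp))
      _ = t.card * Real.exp R := by rw [Finset.sum_const, nsmul_eq_mul]
      _ ≤ Real.exp ℓ * Real.exp R := by gcongr
      _ = _ := (Real.exp_add _ _).symm
  calc ∫ ω, t.sup' ht (fun p => ∑ s, c p s * X ω s) ∂P
      ≤ ∫ ω, ((ℓ + R - 1) + Real.exp (-(ℓ + R)) * ∑ p ∈ t, Real.exp (∑ s, c p s * X ω s)) ∂P :=
        integral_mono
          (hX.integrable (F := fun w => t.sup' ht (fun p => ∑ s, c p s * w s))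
            (Continuous.finset_sup'_apply ht fun p _ => by fun_prop))
          (hX.integrable (F := fun w => (ℓ + R - 1) + Real.exp (-(ℓ + R)) *
            ∑ p ∈ t, Real.exp (∑ s, c p s * w s)) (by fun_prop)) hpt
    _ = (ℓ + R - 1) + Real.exp (-(ℓ + R)) * ∫ ω, ∑ p ∈ t, Real.exp (∑ s, c p s * X ω s) ∂P := by
        rw [integral_add (integrable_const _)
          ((integrable_finsetSum _ fun p _ => iexp p).const_mul _), integral_const_mul]
        simp
    _ ≤ (ℓ + R - 1) + Real.exp (-(ℓ + R)) * Real.exp (ℓ + R) := by gcongr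
    _ = ℓ + R := by rw [← Real.exp_add]; simp

lemma IsNoise.integral_sq_sum_le {X : Ω → σ → ℝ} {a : ℝ} (hX : IsNoise X a P) (s : Finset σ)
    (c : σ → ℝ) : ∫ ω, (∑ i ∈ s, X ω i * c i) ^ 2 ∂P ≤ ∑ i ∈ s, c i ^ 2 := by
  have hL2 : ∀ i, MemLp (fun ω => X ω i * c i) 2 P := fun i => by
    refine (memLp_two_iff_integrable_sq
      ((hX.measurable i).mul_const _).aestronglyMeasurable).2 ?_
    exact hX.integrable (F := fun w => (w i * c i) ^ 2) (by fun_prop)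
  have hind : iIndepFun (fun i ω => X ω i * c i) P :=
    hX.indep.comp (fun i x => x * c i) fun i => measurable_mul_const (c i)
  have hvar := IndepFun.variance_sum (s := s) (X := fun i ω => X ω i * c i) (μ := P)
    (fun i _ => hL2 i) fun i _ j _ hij => hind.indepFun hij
  have h0 : ∀ i, ∫ ω, X ω i * c i ∂P = 0 := fun i => by
    rw [integral_mul_const, hX.mean, zero_mul]
  have i1 : ∀ i, Integrable (fun ω => X ω i * c i) P := fun i =>
    hX.integrable (F := fun w => w i * c i) (by fun_prop)
  have e1 : Var[∑ i ∈ s, fun ω => X ω i * c i; P] = ∫ ω, (∑ i ∈ s, X ω i * c i) ^ 2 ∂P := by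
    rw [variance_of_integral_eq_zero]
    · simp [Finset.sum_apply]
    · have h : (∑ i ∈ s, fun ω => X ω i * c i) = fun ω => ∑ i ∈ s, X ω i * c i := by
        ext ω
        simp [Finset.sum_apply]
      rw [h]
      exact (hX.integrable (F := fun w => ∑ i ∈ s, w i * c i) (by fun_prop)).aemeasurable
    · simp only [Finset.sum_apply]
      rw [integral_finsetSum _ fun i _ => i1 i]
      exact Finset.sum_eq_zero fun i _ => h0 i
  rw [← e1, hvar]
  refine Finset.sum_le_sum fun i _ => ?_
  rw [variance_of_integral_eq_zero ((hX.measurable i).mul_const _).aemeasurable (h0 i)]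
  simp only [mul_pow]
  rw [integral_mul_const]
  nlinarith [hX.sq_le i, sq_nonneg (c i)]

/-- One martingale step: the increment added to `p` has mean zero, so only its second moment enters.
The fourth moment of `X ω k` is controlled by `a²` times the second, and `a² r ≤ 1` absorbs the
factor. -/
lemma IsNoise.integral_sq_add_le {X : Ω → σ → ℝ} {a : ℝ} (hX : IsNoise X a P) (k : σ)
    (p q : ℝ) {r : ℝ} (hr0 : 0 ≤ r) (har : a ^ 2 * r ≤ 1) :
    ∫ ω, (p + (2 * X ω k * q + (X ω k ^ 2 - ∫ ω, X ω k ^ 2 ∂P) * r)) ^ 2 ∂P ≤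
      p ^ 2 + (8 * q ^ 2 + 2 * r) := by
  set v : ℝ := ∫ ω, X ω k ^ 2 ∂P with hv
  have hv0 : 0 ≤ v := integral_nonneg fun ω => sq_nonneg _
  have hv1 : v ≤ 1 := hX.sq_le k
  have hpt : ∀ ω, (p + (2 * X ω k * q + (X ω k ^ 2 - v) * r)) ^ 2 ≤
      (p ^ 2 - 2 * p * v * r + 2 * v ^ 2 * r ^ 2) + 4 * p * q * X ω k +
        (2 * p * r + 8 * q ^ 2 + 2 * a ^ 2 * r ^ 2 - 4 * v * r ^ 2) * X ω k ^ 2 := by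
    intro ω
    have h2 : X ω k ^ 2 ≤ a ^ 2 :=
      sq_le_sq' (abs_le.1 (hX.bound ω k)).1 (abs_le.1 (hX.bound ω k)).2
    have h3 : X ω k ^ 2 * X ω k ^ 2 * r ^ 2 ≤ a ^ 2 * X ω k ^ 2 * r ^ 2 := by gcongr
    nlinarith [sq_nonneg (2 * X ω k * q - (X ω k ^ 2 - v) * r)]
  refine (integral_mono (μ := P)
    (hX.integrable (F := fun w => (p + (2 * w k * q + (w k ^ 2 - v) * r)) ^ 2) (by fun_prop))
    (hX.integrable (F := fun w => (p ^ 2 - 2 * p * v * r + 2 * v ^ 2 * r ^ 2) +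
      4 * p * q * w k + (2 * p * r + 8 * q ^ 2 + 2 * a ^ 2 * r ^ 2 - 4 * v * r ^ 2) * w k ^ 2)
      (by fun_prop)) hpt).trans ?_
  rw [hX.integral_quadratic, ← hv]
  have h4 : q ^ 2 * v ≤ q ^ 2 := by nlinarith [sq_nonneg q]
  have h5 : a ^ 2 * r ^ 2 * v ≤ r := by
    calc a ^ 2 * r ^ 2 * v = (a ^ 2 * r) * (r * v) := by ring
      _ ≤ 1 * (r * 1) := by gcongr
      _ = r := by ring
  nlinarith [mul_nonneg (sq_nonneg v) (sq_nonneg r)]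

/-- Summands are added one at a time. With the earlier partial sum `S` frozen, the new index `k`
costs `8⟨β k, S⟩² + 2‖β k‖²`; the mean of `⟨β k, S⟩²` is at most `∑ ⟨β k, β i⟩² ≤ ‖β k‖²` by `hβ`.
-/
lemma IsNoise.integral_normSq_sub_sq_le [DecidableEq σ] {X : Ω → σ → ℝ} {a b : ℝ}
    (hX : IsNoise X a P)
    {E : Type*} [NormedAddCommGroup E] [InnerProductSpace ℝ E] {β : σ → E}
    (ha : 0 ≤ a) (hab : a * b ≤ 1) (hβb : ∀ i, ‖β i‖ ≤ b)
    (hβ : ∀ u : E, ∑ i, inner ℝ u (β i) ^ 2 ≤ ‖u‖ ^ 2) (s : Finset σ) :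
    ∫ ω, (‖∑ i ∈ s, X ω i • β i‖ ^ 2 - ∑ i ∈ s, (∫ ω, X ω i ^ 2 ∂P) * ‖β i‖ ^ 2) ^ 2 ∂P ≤
      10 * ∑ i ∈ s, ‖β i‖ ^ 2 := by
  induction s using Finset.induction_on with
  | empty => simp
  | insert k s hk ih =>
    have hXm : Measurable X := measurable_pi_lambda _ hX.measurable
    set e : ℝ := ∑ i ∈ s, (∫ ω, X ω i ^ 2 ∂P) * ‖β i‖ ^ 2 with he
    set v : ℝ := ∫ ω, X ω k ^ 2 ∂P with hv
    let S : (σ → ℝ) → E := fun w => ∑ i ∈ s, w i • β i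
    have hS : Continuous S := by fun_prop
    let F : (σ → ℝ) → (σ → ℝ) → ℝ := fun x y => ((‖S y‖ ^ 2 - e) +
      (2 * x k * inner ℝ (β k) (S y) + (x k ^ 2 - v) * ‖β k‖ ^ 2)) ^ 2
    have hF : Continuous (Function.uncurry F) := by
      simp only [F, Function.uncurry_def]
      fun_prop
    let g : (σ → ℝ) → ℝ := fun y => (‖S y‖ ^ 2 - e) ^ 2 + (8 * inner ℝ (β k) (S y) ^ 2 +
      2 * ‖β k‖ ^ 2)
    have hg : Continuous g := by fun_prop
    have hmaskS : ∀ ω, S (coordMask s (X ω)) = S (X ω) := fun ω =>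
      Finset.sum_congr rfl fun i hi => by simp [coordMask, hi]
    have hdisj : Disjoint ({k} : Finset σ) s := by simpa using hk
    have hfix : ∀ ω', ∫ ω, F (coordMask {k} (X ω)) (coordMask s (X ω')) ∂P ≤
        g (coordMask s (X ω')) := by
      intro ω'
      have har : a ^ 2 * ‖β k‖ ^ 2 ≤ 1 := by
        rw [← mul_pow]
        exact pow_le_one₀ (by positivity) ((mul_le_mul_of_nonneg_left (hβb k) ha).trans hab)
      have h1 : ∀ ω, coordMask {k} (X ω) k = X ω k := fun ω => by simp [coordMask]
      simp only [F, g, h1]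
      exact hX.integral_sq_add_le k _ _ (sq_nonneg _) har
    have hmain := integral_le_of_indepFun (P := P) (a := a)
      ((continuous_coordMask {k}).measurable.comp hXm)
      ((continuous_coordMask s).measurable.comp hXm)
      (fun ω i => (abs_coordMask_le _ _ _).trans (hX.bound ω i))
      (fun ω i => (abs_coordMask_le _ _ _).trans (hX.bound ω i))
      (indepFun_coordMask hX.measurable hX.indep hdisj) hF hg hfix
    have hLHS : ∀ ω, (‖∑ i ∈ insert k s, X ω i • β i‖ ^ 2 -
        ∑ i ∈ insert k s, (∫ ω, X ω i ^ 2 ∂P) * ‖β i‖ ^ 2) ^ 2 =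
        F (coordMask {k} (X ω)) (coordMask s (X ω)) := by
      intro ω
      have h1 : coordMask {k} (X ω) k = X ω k := by simp [coordMask]
      simp only [F, h1, hmaskS]
      rw [Finset.sum_insert hk, Finset.sum_insert hk, ← he, ← hv, norm_add_sq_real,
        inner_smul_left, norm_smul, mul_pow, Real.norm_eq_abs, sq_abs]
      simp only [S, conj_trivial]
      ring
    simp only [hLHS]
    refine hmain.trans ?_
    have hgS : ∀ ω, g (coordMask s (X ω)) = (‖S (X ω)‖ ^ 2 - e) ^ 2 +
        (8 * (∑ i ∈ s, X ω i * inner ℝ (β k) (β i)) ^ 2 + 2 * ‖β k‖ ^ 2) := by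
      intro ω
      simp only [g, hmaskS]
      simp [S, inner_sum, inner_smul_right]
    simp only [Function.comp, hgS]
    have j1 : Integrable (fun ω => (‖S (X ω)‖ ^ 2 - e) ^ 2) P :=
      hX.integrable (F := fun w => (‖S w‖ ^ 2 - e) ^ 2) (by fun_prop)
    have j2 : Integrable (fun ω => 8 * (∑ i ∈ s, X ω i * inner ℝ (β k) (β i)) ^ 2) P :=
      hX.integrable (F := fun w => 8 * (∑ i ∈ s, w i * inner ℝ (β k) (β i)) ^ 2) (by fun_prop)
    have j3 : Integrable (fun ω => 8 * (∑ i ∈ s, X ω i * inner ℝ (β k) (β i)) ^ 2 +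
        2 * ‖β k‖ ^ 2) P := j2.add (integrable_const _)
    rw [integral_add j1 j3, integral_add j2 (integrable_const _), integral_const_mul,
      Finset.sum_insert hk]
    have h6 := hX.integral_sq_sum_le s fun i => inner ℝ (β k) (β i)
    have h7 : ∑ i ∈ s, inner ℝ (β k) (β i) ^ 2 ≤ ‖β k‖ ^ 2 :=
      (Finset.sum_le_sum_of_subset_of_nonneg (Finset.subset_univ s)
        fun i _ _ => sq_nonneg _).trans (hβ (β k))
    simp only [integral_const, probReal_univ, one_smul]
    linarith

end Bounded

/-! ### Quadratic expansion of the norm over dyadic vectors. -/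

section Combination

variable {ι κ E : Type*} [Fintype ι] [Fintype κ] [NormedAddCommGroup E] [InnerProductSpace ℝ E]

/-- The product `B w v`, where `B` has the columns `β i`. -/
def columnCombo (β : ι → E) (w : ι × κ → ℝ) (v : κ → ℝ) : E :=
  ∑ j, v j • ∑ i, w (i, j) • β i

lemma continuous_columnCombo (β : ι → E) (v : κ → ℝ) :
    Continuous fun w : ι × κ → ℝ => columnCombo β w v := by
  unfold columnCombo
  fun_prop

lemma inner_columnCombo_left (β : ι → E) (w : ι × κ → ℝ) (v : κ → ℝ) (u : E) :
    inner ℝ (columnCombo β w v) u = ∑ p : ι × κ, v p.2 * inner ℝ u (β p.1) * w p := by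
  rw [columnCombo, sum_inner, Fintype.sum_prod_type_right]
  refine Finset.sum_congr rfl fun j _ => ?_
  rw [inner_smul_left, sum_inner, Finset.mul_sum]
  refine Finset.sum_congr rfl fun i _ => ?_
  rw [inner_smul_left, real_inner_comm]
  simp only [conj_trivial]
  ring

lemma inner_columnCombo (β : ι → E) (w w' : ι × κ → ℝ) (x y : κ → ℝ) :
    inner ℝ (columnCombo β w x) (columnCombo β w' y) =
      ∑ j, ∑ l, x j * y l * inner ℝ (∑ i, w (i, j) • β i) (∑ i, w' (i, l) • β i) := by
  unfold columnCombo
  rw [sum_inner]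
  refine Finset.sum_congr rfl fun j _ => ?_
  rw [inner_sum]
  refine Finset.sum_congr rfl fun l _ => ?_
  rw [inner_smul_left, inner_smul_right]
  simp only [conj_trivial]
  ring

lemma inner_columnCombo_eq_sum_levels (β : ι → E) (w w' : ι × κ → ℝ) {v : κ → ℝ} {K : ℕ}
    (hv : v ∈ dyadicBall κ K) :
    inner ℝ (columnCombo β w v) (columnCombo β w' v) = ∑ k ∈ Finset.range (K + 1),
      (inner ℝ (columnCombo β w fun j => if |v j| = (1 / 2 : ℝ) ^ k then v j else 0)
        (columnCombo β w' fun j => if (1 / 2 : ℝ) ^ k ≤ |v j| then v j else 0) +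
      inner ℝ (columnCombo β w fun j => if (1 / 2 : ℝ) ^ k < |v j| then v j else 0)
        (columnCombo β w' fun j => if |v j| = (1 / 2 : ℝ) ^ k then v j else 0)) := by
  simp only [inner_columnCombo, ← Finset.sum_add_distrib]
  refine Eq.trans (Finset.sum_congr rfl fun j _ => ?_) Finset.sum_comm
  refine Eq.trans (Finset.sum_congr rfl fun l _ => ?_) Finset.sum_comm
  rw [mul_eq_sum_levels ((mem_dyadicBall.1 hv).1 j) ((mem_dyadicBall.1 hv).1 l), Finset.sum_mul]
  exact Finset.sum_congr rfl fun k _ => by ring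

/-- Pairs in the dyadic ball of which the first has entries of size at most `2⁻ᵏ`. -/
noncomputable def dyadicPairs (κ : Type*) [Fintype κ] (k : ℕ) : Finset ((κ → ℝ) × (κ → ℝ)) := by
  classical
  exact (dyadicBall κ k ×ˢ dyadicBall κ k).filter fun p => ∀ j, |p.1 j| ≤ (1 / 2 : ℝ) ^ k

lemma mem_dyadicPairs {k : ℕ} {p : (κ → ℝ) × (κ → ℝ)} :
    p ∈ dyadicPairs κ k ↔
      (p.1 ∈ dyadicBall κ k ∧ p.2 ∈ dyadicBall κ k) ∧ ∀ j, |p.1 j| ≤ (1 / 2 : ℝ) ^ k := by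
  simp [dyadicPairs]

lemma dyadicPairs_nonempty (κ : Type*) [Fintype κ] (k : ℕ) : (dyadicPairs κ k).Nonempty :=
  ⟨(0, 0), mem_dyadicPairs.2 ⟨⟨zero_mem_dyadicBall k, zero_mem_dyadicBall k⟩, fun j => by
    simp⟩⟩

lemma card_dyadicPairs_le {k m : ℕ} (hκ : Fintype.card κ ≤ 4 ^ (k + m)) :
    ((dyadicPairs κ k).card : ℝ) ≤ Real.exp (24 * 4 ^ k * (m + 1)) := by
  have h1 : (dyadicPairs κ k).card ≤ (dyadicBall κ k).card * (dyadicBall κ k).card := by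
    rw [← Finset.card_product]
    exact Finset.card_filter_le _ _
  calc ((dyadicPairs κ k).card : ℝ) ≤ (dyadicBall κ k).card * (dyadicBall κ k).card := by
        exact_mod_cast h1
    _ ≤ Real.exp (12 * 4 ^ k * (m + 1)) * Real.exp (12 * 4 ^ k * (m + 1)) := by
        gcongr <;> exact card_dyadicBall_le hκ
    _ = _ := by rw [← Real.exp_add]; ring_nf

/-- The largest norm of `B w v` over the dyadic ball. -/
noncomputable def dyadicNorm (β : ι → E) (K : ℕ) (w : ι × κ → ℝ) : ℝ :=
  (dyadicBall κ K).sup' ⟨0, zero_mem_dyadicBall K⟩ fun v => ‖columnCombo β w v‖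

/-- The largest inner product of `B w x` and `B w' y` over the dyadic pairs. -/
noncomputable def dyadicForm (β : ι → E) (k : ℕ) (w w' : ι × κ → ℝ) : ℝ :=
  (dyadicPairs κ k).sup' (dyadicPairs_nonempty κ k) fun p =>
    inner ℝ (columnCombo β w p.1) (columnCombo β w' p.2)

lemma continuous_dyadicNorm (β : ι → E) (K : ℕ) :
    Continuous (dyadicNorm (κ := κ) β K) :=
  Continuous.finset_sup'_apply _ fun v _ => (continuous_columnCombo β v).norm

lemma continuous_dyadicForm (β : ι → E) (k : ℕ) :
    Continuous (Function.uncurry (dyadicForm (κ := κ) β k)) :=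
  Continuous.finset_sup'_apply (dyadicPairs_nonempty κ k) fun p _ =>
    ((continuous_columnCombo β p.1).comp continuous_fst).inner
      ((continuous_columnCombo β p.2).comp continuous_snd)

lemma norm_columnCombo_le_dyadicNorm (β : ι → E) {K : ℕ} (w : ι × κ → ℝ) {v : κ → ℝ}
    (hv : v ∈ dyadicBall κ K) : ‖columnCombo β w v‖ ≤ dyadicNorm β K w :=
  Finset.le_sup' (fun v => ‖columnCombo β w v‖) hv

lemma dyadicNorm_nonneg (β : ι → E) (K : ℕ) (w : ι × κ → ℝ) : 0 ≤ dyadicNorm β K w :=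
  (norm_nonneg _).trans (norm_columnCombo_le_dyadicNorm β w (zero_mem_dyadicBall K))

lemma dyadicBall_mono {k K : ℕ} (h : k ≤ K) : dyadicBall κ k ⊆ dyadicBall κ K := by
  intro v hv
  refine dyadicBall_of_eq_or_zero hv fun j => Or.inr ⟨rfl, ?_⟩
  rcases mem_dyadicSet.1 ((mem_dyadicBall.1 hv).1 j) with h0 | ⟨l, hl, h0⟩
  · exact mem_dyadicSet.2 (Or.inl h0)
  · exact mem_dyadicSet.2 (Or.inr ⟨l, hl.trans h, h0⟩)

/-- The columns of index in `T`. -/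
def columnSet (ι : Type*) {κ : Type*} [Fintype ι] [Fintype κ] [DecidableEq κ] (T : Finset κ) :
    Finset (ι × κ) :=
  Finset.univ.filter fun p => p.2 ∈ T

variable [DecidableEq ι] [DecidableEq κ]

lemma columnCombo_coordMask (β : ι → E) (T : Finset κ) (w : ι × κ → ℝ) (v : κ → ℝ) :
    columnCombo β (coordMask (columnSet ι T) w) v =
      columnCombo β w fun j => if j ∈ T then v j else 0 := by
  unfold columnCombo
  refine Finset.sum_congr rfl fun j _ => ?_
  by_cases h : j ∈ T <;> simp [coordMask, columnSet, h]

lemma dyadicNorm_coordMask_le (β : ι → E) (K : ℕ) (T : Finset κ) (w : ι × κ → ℝ) :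
    dyadicNorm β K (coordMask (columnSet ι T) w) ≤ dyadicNorm β K w := by
  refine Finset.sup'_le _ _ fun v hv => ?_
  rw [columnCombo_coordMask]
  refine norm_columnCombo_le_dyadicNorm β w (dyadicBall_of_eq_or_zero hv fun j => ?_)
  by_cases h : j ∈ T
  · simp only [h, if_true]
    exact Or.inr ⟨trivial, (mem_dyadicBall.1 hv).1 j⟩
  · simp [h]

-- At level `k` both truncations of `v` keep only entries of size at least `2⁻ᵏ`, so they lie in the
-- coarser `dyadicBall κ k`, which is what makes the count depend on `k`.
omit [DecidableEq ι] [DecidableEq κ] in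
lemma inner_columnCombo_le_sum_dyadicForm (β : ι → E) (w w' : ι × κ → ℝ) {v : κ → ℝ} {K : ℕ}
    (hv : v ∈ dyadicBall κ K) :
    inner ℝ (columnCombo β w v) (columnCombo β w' v) ≤
      ∑ k ∈ Finset.range (K + 1), (dyadicForm β k w w' + dyadicForm β k w' w) := by
  rw [inner_columnCombo_eq_sum_levels β w w' hv]
  have hmem : ∀ (k : ℕ) (x : κ → ℝ), (∀ j, x j = 0 ∨ (x j = v j ∧ (1 / 2 : ℝ) ^ k ≤ |x j|)) →
      x ∈ dyadicBall κ k := by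
    intro k x hx
    refine dyadicBall_of_eq_or_zero hv fun j => (hx j).imp_right fun h => ⟨h.1, ?_⟩
    rcases mem_dyadicSet.1 ((mem_dyadicBall.1 hv).1 j) with h0 | ⟨l, hl, h0⟩
    · rw [mem_dyadicSet, h.1]; exact Or.inl h0
    · rw [mem_dyadicSet, h.1]
      refine Or.inr ⟨l, ?_, h0⟩
      have h2 := h.2
      rw [h.1, h0] at h2
      exact (pow_le_pow_iff_right_of_lt_one₀ (by norm_num) (by norm_num)).1 h2
  refine Finset.sum_le_sum fun k _ => ?_
  have h1 : (fun j => if |v j| = (1 / 2 : ℝ) ^ k then v j else 0) ∈ dyadicBall κ k :=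
    hmem k _ fun j => by
      by_cases h : |v j| = (1 / 2 : ℝ) ^ k
      · simp only [h, if_true]; exact Or.inr ⟨trivial, le_rfl⟩
      · exact Or.inl (if_neg h)
  have h1' : ∀ j, |if |v j| = (1 / 2 : ℝ) ^ k then v j else 0| ≤ (1 / 2 : ℝ) ^ k := by
    intro j
    by_cases h : |v j| = (1 / 2 : ℝ) ^ k
    · rw [if_pos h, h]
    · rw [if_neg h, abs_zero]; positivity
  have h2 : (fun j => if (1 / 2 : ℝ) ^ k ≤ |v j| then v j else 0) ∈ dyadicBall κ k :=
    hmem k _ fun j => by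
      by_cases h : (1 / 2 : ℝ) ^ k ≤ |v j|
      · simp only [h, if_true]; exact Or.inr ⟨trivial, trivial⟩
      · exact Or.inl (if_neg h)
  have h3 : (fun j => if (1 / 2 : ℝ) ^ k < |v j| then v j else 0) ∈ dyadicBall κ k :=
    hmem k _ fun j => by
      by_cases h : (1 / 2 : ℝ) ^ k < |v j|
      · simp only [h, if_true]; exact Or.inr ⟨trivial, h.le⟩
      · exact Or.inl (if_neg h)
  refine add_le_add ?_ ?_
  · exact Finset.le_sup' (fun p : (κ → ℝ) × (κ → ℝ) =>
      inner ℝ (columnCombo β w p.1) (columnCombo β w' p.2))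
      (mem_dyadicPairs.2 ⟨⟨h1, h2⟩, h1'⟩ : (_, _) ∈ dyadicPairs κ k)
  · rw [real_inner_comm]
    exact Finset.le_sup' (fun p : (κ → ℝ) × (κ → ℝ) =>
      inner ℝ (columnCombo β w' p.1) (columnCombo β w p.2))
      (mem_dyadicPairs.2 ⟨⟨h1, h3⟩, h1'⟩ : (_, _) ∈ dyadicPairs κ k)

/-- The squared norm through its diagonal and decoupled off-diagonal parts. -/
lemma normSq_columnCombo_eq (β : ι → E) (w : ι × κ → ℝ) (v : κ → ℝ) :
    ‖columnCombo β w v‖ ^ 2 = ∑ j, v j ^ 2 * ‖∑ i, w (i, j) • β i‖ ^ 2 +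
      4 / 2 ^ Fintype.card κ * ∑ T : Finset κ,
        inner ℝ (columnCombo β (coordMask (columnSet ι T) w) v)
          (columnCombo β (coordMask (columnSet ι Tᶜ) w) v) := by
  set M : κ → κ → ℝ := fun j l =>
    v j * v l * inner ℝ (∑ i, w (i, j) • β i) (∑ i, w (i, l) • β i) with hM
  have hT : ∀ T : Finset κ, inner ℝ (columnCombo β (coordMask (columnSet ι T) w) v)
      (columnCombo β (coordMask (columnSet ι Tᶜ) w) v) =
      ∑ j, ∑ l, (if j ∈ T ∧ l ∉ T then M j l else 0) := by
    intro T
    rw [columnCombo_coordMask, columnCombo_coordMask, inner_columnCombo]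
    refine Finset.sum_congr rfl fun j _ => Finset.sum_congr rfl fun l _ => ?_
    by_cases hj : j ∈ T <;> by_cases hl : l ∈ T <;> simp [hj, hl, hM]
  simp only [hT]
  rw [← sum_offDiag_eq_average, ← Finset.sum_add_distrib, ← real_inner_self_eq_norm_sq,
    inner_columnCombo]
  refine Finset.sum_congr rfl fun j _ => ?_
  have : ∀ l, M j l = (if j = l then M j l else 0) + (if j = l then 0 else M j l) := by
    intro l; split_ifs <;> simp
  change ∑ l, M j l = _
  rw [Finset.sum_congr rfl fun l _ => this l, Finset.sum_add_distrib, Finset.sum_ite_eq]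
  simp only [Finset.mem_univ, if_true, hM, real_inner_self_eq_norm_sq]
  ring

lemma dyadicNorm_sq_le (β : ι → E) (K : ℕ) (w : ι × κ → ℝ) {n : ℝ} (hn : 0 < n) (e : κ → ℝ)
    (he : ∀ j, e j ≤ n) :
    dyadicNorm β K w ^ 2 ≤
      (10 * n + 5 / (4 * n) * ∑ j, (‖∑ i, w (i, j) • β i‖ ^ 2 - e j) ^ 2) +
      4 / 2 ^ Fintype.card κ * ∑ T : Finset κ, ∑ k ∈ Finset.range (K + 1),
        (dyadicForm β k (coordMask (columnSet ι T) w) (coordMask (columnSet ι Tᶜ) w) +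
          dyadicForm β k (coordMask (columnSet ι Tᶜ) w) (coordMask (columnSet ι T) w)) := by
  obtain ⟨v, hv, hvn⟩ := Finset.exists_mem_eq_sup' ⟨0, zero_mem_dyadicBall K⟩
    fun v : κ → ℝ => ‖columnCombo β w v‖
  have hd : dyadicNorm β K w = ‖columnCombo β w v‖ := hvn
  rw [hd, normSq_columnCombo_eq]
  refine add_le_add ?_ ?_
  · set D : κ → ℝ := fun j => ‖∑ i, w (i, j) • β i‖ ^ 2 - e j with hD
    set Q := ∑ j, D j ^ 2 with hQ
    have hQ0 : 0 ≤ Q := Finset.sum_nonneg fun j _ => sq_nonneg _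
    have h1 : ∀ j, ‖∑ i, w (i, j) • β i‖ ^ 2 ≤ 2 * n + Q / (4 * n) := by
      intro j
      have h2 : D j ^ 2 ≤ Q :=
        Finset.single_le_sum (f := fun j => D j ^ 2) (fun j _ => sq_nonneg _) (Finset.mem_univ j)
      -- From `D ≤ n + D² / (4n)`: the sum `Q` replaces a maximum over columns at the price of a
      -- second moment only.
      have h3 : D j ≤ n + Q / (4 * n) := by
        rw [← sub_le_iff_le_add', le_div_iff₀ (by positivity)]
        nlinarith [sq_nonneg (D j - 2 * n)]
      have h4 : ‖∑ i, w (i, j) • β i‖ ^ 2 = e j + D j := by rw [hD]; ring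
      linarith [he j]
    calc ∑ j, v j ^ 2 * ‖∑ i, w (i, j) • β i‖ ^ 2 ≤ ∑ j, v j ^ 2 * (2 * n + Q / (4 * n)) :=
          Finset.sum_le_sum fun j _ => mul_le_mul_of_nonneg_left (h1 j) (sq_nonneg _)
      _ = (∑ j, v j ^ 2) * (2 * n + Q / (4 * n)) := by rw [Finset.sum_mul]
      _ ≤ 5 * (2 * n + Q / (4 * n)) :=
          mul_le_mul_of_nonneg_right (mem_dyadicBall.1 hv).2 (by positivity)
      _ = 10 * n + 5 / (4 * n) * Q := by ring
  · refine mul_le_mul_of_nonneg_left (Finset.sum_le_sum fun T _ => ?_) (by positivity)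
    exact inner_columnCombo_le_sum_dyadicForm β _ _ hv

/-- The factor `K - k + 1` from the cardinality is beaten by the geometric growth, so no logarithm
is lost. -/
lemma sum_two_pow_mul_le (K : ℕ) :
    ∑ k ∈ Finset.range (K + 1), (2 : ℝ) ^ k * ((K - k : ℕ) + 1) ≤ 4 * 2 ^ K := by
  have h : ∑ k ∈ Finset.range (K + 1), (2 : ℝ) ^ k * ((K - k : ℕ) + 1) = 4 * 2 ^ K - K - 3 := by
    induction K with
    | zero => norm_num
    | succ K ih =>
      rw [Finset.sum_range_succ]
      have h1 : ∑ k ∈ Finset.range (K + 1), (2 : ℝ) ^ k * ((K + 1 - k : ℕ) + 1) =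
          ∑ k ∈ Finset.range (K + 1), (2 : ℝ) ^ k * ((K - k : ℕ) + 1) +
            ∑ k ∈ Finset.range (K + 1), (2 : ℝ) ^ k := by
        rw [← Finset.sum_add_distrib]
        refine Finset.sum_congr rfl fun k hk => ?_
        rw [Nat.succ_sub (Nat.lt_succ_iff.1 (Finset.mem_range.1 hk))]
        push_cast
        ring
      rw [h1, ih, geom_sum_eq (by norm_num)]
      simp only [Nat.sub_self]
      push_cast
      ring
  rw [h]
  linarith [Nat.cast_nonneg (α := ℝ) K]

/-! ### Expected size of the decoupled forms. -/

variable {Ω : Type*} [MeasurableSpace Ω] {P : Measure Ω} [IsProbabilityMeasure P]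
  {X : Ω → ι × κ → ℝ} {a b : ℝ} {β : ι → E}

lemma IsNoise.integral_sup'_inner_le (hX : IsNoise X a P) (ha : 0 ≤ a) (hab : a * b ≤ 1)
    (hβb : ∀ i, ‖β i‖ ≤ b) (hβ : ∀ u : E, ∑ i, inner ℝ u (β i) ^ 2 ≤ ‖u‖ ^ 2) {k m : ℕ}
    (hκ : Fintype.card κ ≤ 4 ^ (k + m)) (S : Finset (ι × κ)) {q : (κ → ℝ) → E} {G : ℝ}
    (hq : ∀ y ∈ dyadicBall κ k, ‖q y‖ ≤ G) :
    ∫ ω, (dyadicPairs κ k).sup' (dyadicPairs_nonempty κ k) (fun p =>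
      inner ℝ (columnCombo β (coordMask S (X ω)) p.1) (q p.2)) ∂P ≤ 29 * 2 ^ k * (m + 1) * G := by
  have hG0 : 0 ≤ G := (norm_nonneg _).trans (hq 0 (zero_mem_dyadicBall k))
  rcases hG0.eq_or_lt with rfl | hG
  · rw [mul_zero]
    refine integral_nonpos fun ω => Finset.sup'_le _ _ fun p hp => ?_
    have : q p.2 = 0 := norm_le_zero_iff.1 (hq _ (mem_dyadicPairs.1 hp).1.2)
    rw [this, inner_zero_right]
    rfl
  -- The scaling that balances all constraints: coefficients satisfy `a |c| ≤ a b ≤ 1`, while their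
  -- square sum `5·4ᵏ` does not exceed the order of the log-cardinality `24·4ᵏ(m+1)`.
  set lam : ℝ := 2 ^ k / G with hlam
  have hlam0 : 0 < lam := by positivity
  set c : (κ → ℝ) × (κ → ℝ) → ι × κ → ℝ := fun p s =>
    lam * (if s ∈ S then p.1 s.2 * inner ℝ (q p.2) (β s.1) else 0) with hc
  have hcs : ∀ p s, |c p s| ≤ lam * (|p.1 s.2| * |inner ℝ (q p.2) (β s.1)|) := by
    intro p s
    rw [hc, abs_mul, abs_of_pos hlam0, ← abs_mul]
    refine mul_le_mul_of_nonneg_left ?_ hlam0.le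
    split_ifs
    · exact le_rfl
    · rw [abs_zero]; exact abs_nonneg _
  have h2k : (2 : ℝ) ^ k * (1 / 2) ^ k = 1 := by rw [← mul_pow]; norm_num
  have hsup : ∀ p ∈ dyadicPairs κ k, ∀ s, a * |c p s| ≤ 1 := by
    intro p hp s
    have hin : |inner ℝ (q p.2) (β s.1)| ≤ G * b :=
      (abs_real_inner_le_norm _ _).trans
        (mul_le_mul (hq _ (mem_dyadicPairs.1 hp).1.2) (hβb _) (norm_nonneg _) hG0)
    calc a * |c p s| ≤ a * (lam * ((1 / 2) ^ k * (G * b))) := by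
          refine mul_le_mul_of_nonneg_left ((hcs p s).trans ?_) ha
          refine mul_le_mul_of_nonneg_left ?_ hlam0.le
          exact mul_le_mul ((mem_dyadicPairs.1 hp).2 _) hin (abs_nonneg _) (by positivity)
      _ = (2 ^ k * (1 / 2) ^ k) * (a * b) := by rw [hlam]; field_simp
      _ ≤ 1 := by rw [h2k, one_mul]; exact hab
  have hl2 : ∀ p ∈ dyadicPairs κ k, ∑ s, c p s ^ 2 ≤ 5 * 4 ^ k := by
    intro p hp
    have hp' := mem_dyadicPairs.1 hp
    calc ∑ s, c p s ^ 2 ≤ ∑ s : ι × κ, lam ^ 2 * (p.1 s.2 ^ 2 * inner ℝ (q p.2) (β s.1) ^ 2) := by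
          refine Finset.sum_le_sum fun s _ => ?_
          rw [← sq_abs (c p s), ← sq_abs (p.1 s.2), ← sq_abs (inner ℝ (q p.2) (β s.1)), ← mul_pow,
            ← mul_pow]
          exact pow_le_pow_left₀ (abs_nonneg _) (hcs p s) 2
      _ = lam ^ 2 * ((∑ j, p.1 j ^ 2) * ∑ i, inner ℝ (q p.2) (β i) ^ 2) := by
          rw [← Finset.mul_sum, Fintype.sum_prod_type_right, Finset.sum_mul]
          simp only [Finset.mul_sum]
      _ ≤ lam ^ 2 * (5 * G ^ 2) := by
          refine mul_le_mul_of_nonneg_left ?_ (sq_nonneg _)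
          refine mul_le_mul (mem_dyadicBall.1 hp'.1.1).2 ?_
            (Finset.sum_nonneg fun _ _ => sq_nonneg _) (by norm_num)
          exact (hβ _).trans (pow_le_pow_left₀ (norm_nonneg _) (hq _ hp'.1.2) 2)
      _ = 5 * 4 ^ k := by
          have : (4 : ℝ) ^ k = 2 ^ k * 2 ^ k := by rw [← mul_pow]; norm_num
          rw [hlam, this]
          field_simp
  have hmain := hX.integral_sup'_le (dyadicPairs_nonempty κ k) hsup hl2 (card_dyadicPairs_le hκ)
  have hsum : ∀ ω p, lam * inner ℝ (columnCombo β (coordMask S (X ω)) p.1) (q p.2) =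
      ∑ s, c p s * X ω s := by
    intro ω p
    rw [inner_columnCombo_left, Finset.mul_sum]
    refine Finset.sum_congr rfl fun s _ => ?_
    by_cases h : s ∈ S <;> simp [hc, coordMask, h, mul_assoc]
  have hcont : Continuous fun w : ι × κ → ℝ =>
      (dyadicPairs κ k).sup' (dyadicPairs_nonempty κ k) fun p => ∑ s, c p s * w s :=
    Continuous.finset_sup'_apply _ fun p _ => by fun_prop
  have hcont' : Continuous fun w : ι × κ → ℝ =>
      (dyadicPairs κ k).sup' (dyadicPairs_nonempty κ k) fun p =>
        inner ℝ (columnCombo β (coordMask S w) p.1) (q p.2) :=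
    Continuous.finset_sup'_apply _ fun p _ =>
      ((continuous_columnCombo β p.1).comp (continuous_coordMask S)).inner continuous_const
  have hle := integral_mono (μ := P) (hX.integrable hcont')
    ((hX.integrable hcont).const_mul lam⁻¹) fun ω => by
      refine Finset.sup'_le _ _ fun p hp => ?_
      have h1 := Finset.le_sup' (fun p => ∑ s, c p s * X ω s) hp
      rw [← hsum] at h1
      have h2 := mul_le_mul_of_nonneg_left h1 (inv_pos.2 hlam0).le
      rwa [inv_mul_cancel_left₀ hlam0.ne'] at h2
  refine hle.trans ?_
  rw [integral_const_mul]
  refine (mul_le_mul_of_nonneg_left hmain (inv_pos.2 hlam0).le).trans ?_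
  have h5 : 24 * 4 ^ k * ((m : ℝ) + 1) + 5 * 4 ^ k ≤ 29 * (2 ^ k * 2 ^ k) * (m + 1) := by
    have : (4 : ℝ) ^ k = 2 ^ k * 2 ^ k := by rw [← mul_pow]; norm_num
    rw [← this]
    nlinarith [mul_nonneg (pow_nonneg (show (0 : ℝ) ≤ 4 by norm_num) k) (Nat.cast_nonneg (α := ℝ) m)]
  calc lam⁻¹ * (24 * 4 ^ k * ((m : ℝ) + 1) + 5 * 4 ^ k)
      ≤ lam⁻¹ * (29 * (2 ^ k * 2 ^ k) * (m + 1)) := mul_le_mul_of_nonneg_left h5 (inv_pos.2 hlam0).le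
    _ = 29 * 2 ^ k * (m + 1) * G := by rw [hlam]; field_simp

/-- The columns in `U` are frozen, and `G` is the dyadic norm of the matrix masked to `U`. Masking
only zeroes entries of the test vector, so it does not increase that norm. -/
lemma IsNoise.integral_dyadicForm_le (hX : IsNoise X a P) (ha : 0 ≤ a) (hab : a * b ≤ 1)
    (hβb : ∀ i, ‖β i‖ ≤ b) (hβ : ∀ u : E, ∑ i, inner ℝ u (β i) ^ 2 ≤ ‖u‖ ^ 2) {k K : ℕ}
    (hk : k ≤ K) (hκ : Fintype.card κ ≤ 4 ^ K) {T U : Finset κ} (hTU : Disjoint T U) :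
    ∫ ω, dyadicForm β k (coordMask (columnSet ι T) (X ω)) (coordMask (columnSet ι U) (X ω)) ∂P ≤
      29 * 2 ^ k * ((K - k : ℕ) + 1) * ∫ ω, dyadicNorm β K (X ω) ∂P := by
  have hXm : Measurable X := measurable_pi_lambda _ hX.measurable
  have hdisj : Disjoint (columnSet ι T) (columnSet ι U) := by
    rw [Finset.disjoint_left]
    intro p hp hp'
    simp only [columnSet, Finset.mem_filter, Finset.mem_univ, true_and] at hp hp'
    exact Finset.disjoint_left.1 hTU hp hp'
  have hg : Continuous fun w : ι × κ → ℝ => 29 * 2 ^ k * (((K - k : ℕ) : ℝ) + 1) *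
      dyadicNorm β K w := continuous_const.mul (continuous_dyadicNorm β K)
  have h := integral_le_of_indepFun (P := P) (a := a)
    ((continuous_coordMask (columnSet ι T)).measurable.comp hXm)
    ((continuous_coordMask (columnSet ι U)).measurable.comp hXm)
    (fun ω i => (abs_coordMask_le _ _ _).trans (hX.bound ω i))
    (fun ω i => (abs_coordMask_le _ _ _).trans (hX.bound ω i))
    (indepFun_coordMask hX.measurable hX.indep hdisj) (continuous_dyadicForm β k) hg
    fun ω' => hX.integral_sup'_inner_le ha hab hβb hβ (m := K - k)
      (by rwa [Nat.add_sub_cancel' hk]) (columnSet ι T)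
      fun y hy => norm_columnCombo_le_dyadicNorm β _ (dyadicBall_mono hk hy)
  refine h.trans ?_
  simp only [Function.comp]
  rw [integral_const_mul]
  refine mul_le_mul_of_nonneg_left ?_ (by positivity)
  exact integral_mono (hX.integrable ((continuous_dyadicNorm β K).comp (continuous_coordMask _)))
    (hX.integrable (continuous_dyadicNorm β K)) fun ω => dyadicNorm_coordMask_le β K U (X ω)

omit [Fintype κ] [DecidableEq κ] in
lemma IsNoise.integral_normSq_column_le (hX : IsNoise X a P) (ha : 0 ≤ a) (hab : a * b ≤ 1)
    (hβb : ∀ i, ‖β i‖ ≤ b) (hβ : ∀ u : E, ∑ i, inner ℝ u (β i) ^ 2 ≤ ‖u‖ ^ 2) (j : κ) :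
    ∫ ω, (‖∑ i, X ω (i, j) • β i‖ ^ 2 -
      ∑ i, (∫ ω, X ω (i, j) ^ 2 ∂P) * ‖β i‖ ^ 2) ^ 2 ∂P ≤ 10 * ∑ i, ‖β i‖ ^ 2 := by
  have hcol : IsNoise (fun ω i => X ω (i, j)) a P :=
    { measurable := fun i => hX.measurable _
      indep := hX.indep.precomp (g := fun i => (i, j)) fun i i' h => (Prod.mk.inj h).1
      mean := fun i => hX.mean _
      sq_le := fun i => hX.sq_le _
      bound := fun ω i => hX.bound ω _ }
  exact hcol.integral_normSq_sub_sq_le ha hab hβb hβ Finset.univ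

end Combination

/-! ### The self-bounding inequality for the dyadic norm. -/

section NormBound

variable {ι κ E : Type*} [Fintype ι] [Fintype κ] [NormedAddCommGroup E] [InnerProductSpace ℝ E]
  [DecidableEq ι] [DecidableEq κ]

/-- The decoupled inner products at the scale `2⁻ᵏ` for the columns in `T` against the others. -/
noncomputable def splitForm (β : ι → E) (T : Finset κ) (k : ℕ) (w : ι × κ → ℝ) : ℝ :=
  dyadicForm β k (coordMask (columnSet ι T) w) (coordMask (columnSet ι Tᶜ) w) +
    dyadicForm β k (coordMask (columnSet ι Tᶜ) w) (coordMask (columnSet ι T) w)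

lemma continuous_dyadicForm_coordMask (β : ι → E) (T U : Finset κ) (k : ℕ) :
    Continuous fun w : ι × κ → ℝ =>
      dyadicForm β k (coordMask (columnSet ι T) w) (coordMask (columnSet ι U) w) :=
  Continuous.finset_sup'_apply (dyadicPairs_nonempty κ k) fun p _ =>
    ((continuous_columnCombo β p.1).comp (continuous_coordMask (columnSet ι T))).inner
      ((continuous_columnCombo β p.2).comp (continuous_coordMask (columnSet ι U)))

lemma continuous_splitForm (β : ι → E) (T : Finset κ) (k : ℕ) : Continuous (splitForm β T k) :=
  (continuous_dyadicForm_coordMask β T Tᶜ k).add (continuous_dyadicForm_coordMask β Tᶜ T k)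

variable {Ω : Type*} [MeasurableSpace Ω] {P : Measure Ω} [IsProbabilityMeasure P]
  {X : Ω → ι × κ → ℝ} {a b : ℝ} {β : ι → E}

lemma IsNoise.integral_splitForm_le (hX : IsNoise X a P) (ha : 0 ≤ a) (hab : a * b ≤ 1)
    (hβb : ∀ i, ‖β i‖ ≤ b) (hβ : ∀ u : E, ∑ i, inner ℝ u (β i) ^ 2 ≤ ‖u‖ ^ 2) {k K : ℕ}
    (hk : k ≤ K) (hκ : Fintype.card κ ≤ 4 ^ K) (T : Finset κ) :
    ∫ ω, splitForm β T k (X ω) ∂P ≤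
      58 * (∫ ω, dyadicNorm β K (X ω) ∂P) * (2 ^ k * ((K - k : ℕ) + 1)) := by
  have h1 := hX.integral_dyadicForm_le ha hab hβb hβ hk hκ
    (disjoint_compl_right : Disjoint T Tᶜ)
  have h2 := hX.integral_dyadicForm_le ha hab hβb hβ hk hκ
    (disjoint_compl_left : Disjoint Tᶜ T)
  unfold splitForm
  rw [integral_add (hX.integrable (continuous_dyadicForm_coordMask β T Tᶜ k))
    (hX.integrable (continuous_dyadicForm_coordMask β Tᶜ T k))]
  linarith

lemma IsNoise.integral_sum_splitForm_le (hX : IsNoise X a P) (ha : 0 ≤ a) (hab : a * b ≤ 1)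
    (hβb : ∀ i, ‖β i‖ ≤ b) (hβ : ∀ u : E, ∑ i, inner ℝ u (β i) ^ 2 ≤ ‖u‖ ^ 2) {K : ℕ}
    (hκ : Fintype.card κ ≤ 4 ^ K) :
    ∫ ω, ∑ T : Finset κ, ∑ k ∈ Finset.range (K + 1), splitForm β T k (X ω) ∂P ≤
      2 ^ Fintype.card κ * (232 * 2 ^ K * ∫ ω, dyadicNorm β K (X ω) ∂P) := by
  have hx0 : 0 ≤ ∫ ω, dyadicNorm β K (X ω) ∂P :=
    integral_nonneg fun ω => dyadicNorm_nonneg β K _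
  have hT : ∀ T : Finset κ, ∫ ω, ∑ k ∈ Finset.range (K + 1), splitForm β T k (X ω) ∂P ≤
      232 * 2 ^ K * ∫ ω, dyadicNorm β K (X ω) ∂P := by
    intro T
    rw [integral_finsetSum _ fun k _ => hX.integrable (continuous_splitForm β T k)]
    refine (Finset.sum_le_sum fun k hk => hX.integral_splitForm_le ha hab hβb hβ
      (Nat.lt_succ_iff.1 (Finset.mem_range.1 hk)) hκ T).trans ?_
    rw [← Finset.mul_sum]
    have h := mul_le_mul_of_nonneg_left (sum_two_pow_mul_le K)
      (mul_nonneg (by norm_num : (0 : ℝ) ≤ 58) hx0)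
    linarith
  rw [integral_finsetSum _ fun T _ =>
    integrable_finsetSum _ fun k _ => hX.integrable (continuous_splitForm β T k)]
  refine (Finset.sum_le_sum fun T _ => hT T).trans (le_of_eq ?_)
  rw [Finset.sum_const, Finset.card_univ, Fintype.card_finset, nsmul_eq_mul]
  push_cast
  rfl

lemma IsNoise.integral_dyadicNorm_sq_le (hX : IsNoise X a P) (ha : 0 ≤ a) (hab : a * b ≤ 1)
    (hβb : ∀ i, ‖β i‖ ≤ b) (hβ : ∀ u : E, ∑ i, inner ℝ u (β i) ^ 2 ≤ ‖u‖ ^ 2)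
    {n : ℝ} (hn : n = Fintype.card κ) (hn0 : 0 < n)
    (hβs : ∑ i, ‖β i‖ ^ 2 ≤ n) {K : ℕ} (hκ : Fintype.card κ ≤ 4 ^ K) :
    ∫ ω, dyadicNorm β K (X ω) ^ 2 ∂P ≤
      23 * n + 928 * (2 ^ K * ∫ ω, dyadicNorm β K (X ω) ∂P) := by
  obtain ⟨e, he⟩ : ∃ e : κ → ℝ, ∀ j, e j = ∑ i, (∫ ω, X ω (i, j) ^ 2 ∂P) * ‖β i‖ ^ 2 :=
    ⟨_, fun _ => rfl⟩
  have hen : ∀ j, e j ≤ n := fun j => by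
    rw [he]
    refine le_trans (Finset.sum_le_sum fun i _ => ?_) hβs
    nlinarith [hX.sq_le (i, j), sq_nonneg ‖β i‖]
  have hDc : ∀ j, Continuous fun w : ι × κ → ℝ => (‖∑ i, w (i, j) • β i‖ ^ 2 - e j) ^ 2 :=
    fun j => by fun_prop
  have hsumD : ∫ ω, ∑ j, (‖∑ i, X ω (i, j) • β i‖ ^ 2 - e j) ^ 2 ∂P ≤ 10 * n * n := by
    rw [integral_finsetSum _ fun j _ => hX.integrable (hDc j)]
    calc _ ≤ ∑ j : κ, 10 * n := Finset.sum_le_sum fun j _ => by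
          rw [he]
          exact (hX.integral_normSq_column_le ha hab hβb hβ j).trans (by linarith)
      _ = _ := by
          rw [Finset.sum_const, Finset.card_univ, nsmul_eq_mul, ← hn]
          ring
  have hsumΦ := hX.integral_sum_splitForm_le ha hab hβb hβ hκ
  have c3 : Continuous fun w : ι × κ → ℝ =>
      5 / (4 * n) * ∑ j, (‖∑ i, w (i, j) • β i‖ ^ 2 - e j) ^ 2 :=
    continuous_const.mul (continuous_finsetSum _ fun j _ => hDc j)
  have c1 : Continuous fun w : ι × κ → ℝ =>
      10 * n + 5 / (4 * n) * ∑ j, (‖∑ i, w (i, j) • β i‖ ^ 2 - e j) ^ 2 :=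
    continuous_const.add c3
  have c2 : Continuous fun w : ι × κ → ℝ => 4 / 2 ^ Fintype.card κ *
      ∑ T : Finset κ, ∑ k ∈ Finset.range (K + 1), splitForm β T k w :=
    continuous_const.mul (continuous_finsetSum _ fun T _ =>
      continuous_finsetSum _ fun k _ => continuous_splitForm β T k)
  refine (integral_mono (hX.integrable ((continuous_dyadicNorm β K).pow 2))
    (hX.integrable (c1.add c2)) fun ω => dyadicNorm_sq_le β K (X ω) hn0 e hen).trans ?_
  simp only [Pi.add_apply]
  rw [integral_add (hX.integrable c1) (hX.integrable c2),
    integral_add (integrable_const _) (hX.integrable c3)]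
  have h1 := mul_le_mul_of_nonneg_left hsumD (show 0 ≤ 5 / (4 * n) by positivity)
  have h2 := mul_le_mul_of_nonneg_left hsumΦ (show (0 : ℝ) ≤ 4 / 2 ^ Fintype.card κ by positivity)
  have h3 : 5 / (4 * n) * (10 * n * n) = 25 / 2 * n := by field_simp; ring
  have h4 : ∀ y : ℝ, (4 : ℝ) / 2 ^ Fintype.card κ * (2 ^ Fintype.card κ * y) = 4 * y := by
    intro y
    field_simp
  rw [h3] at h1
  rw [h4] at h2
  simp only [integral_const_mul, integral_const, probReal_univ, one_smul]
  linarith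

theorem IsNoise.integral_dyadicNorm_le (hX : IsNoise X a P) (ha : 0 ≤ a) (hab : a * b ≤ 1)
    (hβb : ∀ i, ‖β i‖ ≤ b) (hβ : ∀ u : E, ∑ i, inner ℝ u (β i) ^ 2 ≤ ‖u‖ ^ 2)
    (hβs : ∑ i, ‖β i‖ ^ 2 ≤ Fintype.card κ) (hκ0 : 0 < Fintype.card κ) {K : ℕ}
    (hκ : Fintype.card κ ≤ 4 ^ K) (hK : 4 ^ K ≤ 4 * Fintype.card κ) :
    ∫ ω, dyadicNorm β K (X ω) ∂P ≤ 1857 * √(Fintype.card κ) := by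
  have hn0 : (0 : ℝ) < Fintype.card κ := Nat.cast_pos.2 hκ0
  have hsq := hX.integral_dyadicNorm_sq_le ha hab hβb hβ rfl hn0 hβs hκ
  have hx0 : 0 ≤ ∫ ω, dyadicNorm β K (X ω) ∂P :=
    integral_nonneg fun ω => dyadicNorm_nonneg β K _
  have hxsq : (∫ ω, dyadicNorm β K (X ω) ∂P) ^ 2 ≤ ∫ ω, dyadicNorm β K (X ω) ^ 2 ∂P := by
    have hm : MemLp (fun ω => dyadicNorm β K (X ω)) 2 P :=
      (memLp_two_iff_integrable_sq (hX.integrable (continuous_dyadicNorm β K)).1).2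
        (hX.integrable ((continuous_dyadicNorm β K).pow 2))
    have h := variance_nonneg (fun ω => dyadicNorm β K (X ω)) P
    rw [variance_eq_sub hm] at h
    simpa using sub_nonneg.1 h
  have h2K : (2 : ℝ) ^ K ≤ 2 * √(Fintype.card κ) := by
    have h4 : ((2 : ℝ) ^ K) ^ 2 ≤ (2 * √(Fintype.card κ)) ^ 2 := by
      rw [mul_pow, Real.sq_sqrt hn0.le, ← pow_mul, mul_comm K 2, pow_mul]
      norm_num
      exact_mod_cast hK
    exact le_of_sq_le_sq h4 (by positivity)
  have hs := Real.sq_sqrt hn0.le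
  have hs0 := Real.sqrt_pos.2 hn0
  have h6 := mul_le_mul_of_nonneg_right h2K hx0
  generalize ∫ ω, dyadicNorm β K (X ω) ∂P = x at *
  generalize ∫ ω, dyadicNorm β K (X ω) ^ 2 ∂P = z at *
  generalize √(Fintype.card κ : ℝ) = r at *
  rw [← hs] at hsq
  -- Now `x² ≤ 23 r² + 1856 r x`, which is impossible for `x > 1857 r`.
  by_contra hcon
  push Not at hcon
  nlinarith

end NormBound

/-- Duality: rounding `x` for the linear functional `v ↦ ⟨B w v, u⟩`, with `u = B w x`, gives `‖u‖²
≤ ⟨B w y, u⟩` for some dyadic `y`. Hence no constant is lost. -/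
lemma norm_columnCombo_le_dyadicNorm_of_sum_sq_le {ι κ E : Type*} [Fintype ι] [Fintype κ]
    [NormedAddCommGroup E] [InnerProductSpace ℝ E] (β : ι → E) {K : ℕ}
    (hκ : Fintype.card κ ≤ 4 ^ K) (w : ι × κ → ℝ) {x : κ → ℝ} (hx : ∑ j, x j ^ 2 ≤ 1) :
    ‖columnCombo β w x‖ ≤ dyadicNorm β K w := by
  set u := columnCombo β w x with hu
  have hin : ∀ v : κ → ℝ, inner ℝ (columnCombo β w v) u =
      ∑ j, v j * inner ℝ (∑ i, w (i, j) • β i) u := by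
    intro v
    rw [columnCombo, sum_inner]
    exact Finset.sum_congr rfl fun j _ => by rw [inner_smul_left]; simp only [conj_trivial]
  obtain ⟨y, hy, hle⟩ := exists_dyadicBall_sum_ge hκ hx fun j => inner ℝ (∑ i, w (i, j) • β i) u
  rw [← hin, ← hin, ← hu, real_inner_self_eq_norm_sq] at hle
  have h1 : ‖u‖ * ‖u‖ ≤ dyadicNorm β K w * ‖u‖ := by
    rw [← sq]
    refine hle.trans ((real_inner_le_norm _ _).trans ?_)
    exact mul_le_mul_of_nonneg_right (norm_columnCombo_le_dyadicNorm β w hy) (norm_nonneg _)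
  rcases (norm_nonneg u).eq_or_lt with h0 | h0
  · rw [← h0]; exact dyadicNorm_nonneg β K w
  · exact le_of_mul_le_mul_right h1 h0

/-! ### Transfer to matrices and the spectral norm. -/

section Matrix

variable {N n : ℕ}

/-- The columns of a matrix as Euclidean vectors. -/
noncomputable def euclideanCol (B : Matrix (Fin n) (Fin N) ℝ) (i : Fin N) :
    EuclideanSpace ℝ (Fin n) :=
  WithLp.toLp 2 (B.col i)

lemma toLp_mulVec_mul_eq_columnCombo (B : Matrix (Fin n) (Fin N) ℝ) (w : Fin N × Fin n → ℝ)
    (v : Fin n → ℝ) :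
    (WithLp.toLp 2 ((B * Matrix.of fun i j => w (i, j)).mulVec v) : EuclideanSpace ℝ (Fin n)) =
      columnCombo (euclideanCol B) w v := by
  ext r
  simp only [columnCombo, euclideanCol, Matrix.mulVec, dotProduct, Matrix.mul_apply,
    Matrix.of_apply, WithLp.ofLp_sum, WithLp.ofLp_smul, Finset.sum_apply, Pi.smul_apply,
    smul_eq_mul, Matrix.col_apply]
  refine Finset.sum_congr rfl fun j _ => ?_
  rw [mul_comm]
  congr 1
  exact Finset.sum_congr rfl fun i _ => mul_comm _ _

lemma norm_mul_le_dyadicNorm (B : Matrix (Fin n) (Fin N) ℝ) {K : ℕ} (hK : n ≤ 4 ^ K)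
    (w : Fin N × Fin n → ℝ) :
    ‖B * Matrix.of fun i j => w (i, j)‖ ≤ dyadicNorm (euclideanCol B) K w := by
  rw [Matrix.l2_opNorm_def]
  refine ContinuousLinearMap.opNorm_le_of_unit_norm (dyadicNorm_nonneg _ K w) fun x hx => ?_
  have h := norm_columnCombo_le_dyadicNorm_of_sum_sq_le (euclideanCol B) (K := K)
    (by simpa using hK) w (x := x.ofLp) (by
      have := EuclideanSpace.real_norm_sq_eq x
      rw [hx] at this
      linarith)
  rw [← toLp_mulVec_mul_eq_columnCombo] at h
  exact h

lemma sum_inner_euclideanCol_sq_le {B : Matrix (Fin n) (Fin N) ℝ} (hB : ‖B‖ ≤ 1)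
    (u : EuclideanSpace ℝ (Fin n)) : ∑ i, inner ℝ u (euclideanCol B i) ^ 2 ≤ ‖u‖ ^ 2 := by
  have hT : ‖B.transpose‖ ≤ 1 := by
    rw [← Matrix.conjTranspose_eq_transpose_of_trivial, Matrix.l2_opNorm_conjTranspose]
    exact hB
  have h := Matrix.l2_opNorm_mulVec B.transpose u
  have h1 := h.trans (mul_le_mul_of_nonneg_right hT (norm_nonneg u))
  rw [one_mul] at h1
  have h2 := pow_le_pow_left₀ (norm_nonneg _) h1 2
  rw [EuclideanSpace.real_norm_sq_eq] at h2
  refine le_trans (le_of_eq (Finset.sum_congr rfl fun i _ => ?_)) h2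
  congr 1

/-- The squared Hilbert–Schmidt norm, computed by rows: each of the `n` basis vectors contributes at
most one. -/
lemma sum_norm_euclideanCol_sq_le {B : Matrix (Fin n) (Fin N) ℝ} (hB : ‖B‖ ≤ 1) :
    ∑ i, ‖euclideanCol B i‖ ^ 2 ≤ n := by
  calc ∑ i, ‖euclideanCol B i‖ ^ 2
      = ∑ r, ∑ i, inner ℝ (EuclideanSpace.single r (1 : ℝ)) (euclideanCol B i) ^ 2 := by
        rw [Finset.sum_comm]
        refine Finset.sum_congr rfl fun i _ => ?_
        rw [EuclideanSpace.real_norm_sq_eq]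
        refine Finset.sum_congr rfl fun r _ => ?_
        rw [EuclideanSpace.inner_single_left]
        simp
    _ ≤ ∑ r : Fin n, (1 : ℝ) := Finset.sum_le_sum fun r _ => by
        refine (sum_inner_euclideanCol_sq_le hB _).trans ?_
        simp
    _ = n := by simp

lemma norm_euclideanCol_le_one {B : Matrix (Fin n) (Fin N) ℝ} (hB : ‖B‖ ≤ 1) (i : Fin N) :
    ‖euclideanCol B i‖ ≤ 1 := by
  have h := (Finset.single_le_sum (f := fun l => inner ℝ (euclideanCol B i) (euclideanCol B l) ^ 2)
    (fun l _ => sq_nonneg _) (Finset.mem_univ i)).trans (sum_inner_euclideanCol_sq_le hB _)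
  simp only [real_inner_self_eq_norm_sq] at h
  by_contra hcon
  push Not at hcon
  nlinarith [mul_pos (show 0 < ‖euclideanCol B i‖ ^ 2 by positivity)
    (show 0 < ‖euclideanCol B i‖ ^ 2 - 1 by nlinarith)]

lemma continuous_norm_mul_of (B : Matrix (Fin n) (Fin N) ℝ) :
    Continuous fun w : Fin N × Fin n → ℝ => ‖B * Matrix.of fun i j => w (i, j)‖ := by
  have h : Continuous fun w : Fin N × Fin n → ℝ =>
      (Matrix.of fun i j => w (i, j) : Matrix (Fin N) (Fin n) ℝ) :=
    continuous_matrix fun i j => continuous_apply (i, j)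
  exact (continuous_const.matrix_mul h).norm

variable {Ω : Type*} [MeasurableSpace Ω] {P : Measure Ω} [IsProbabilityMeasure P]

theorem IsNoise.integral_norm_mul_le {X : Ω → Fin N × Fin n → ℝ} {a b : ℝ} (hX : IsNoise X a P)
    (ha : 0 ≤ a) (hab : a * b ≤ 1) (hn : 0 < n) {B : Matrix (Fin n) (Fin N) ℝ} (hB : ‖B‖ ≤ 1)
    (hBb : ∀ i, ‖euclideanCol B i‖ ≤ b) :
    ∫ ω, ‖B * Matrix.of fun i j => X ω (i, j)‖ ∂P ≤ 1857 * √n := by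
  -- The choice `K = Nat.log 4 n + 1` gives `n ≤ 4 ^ K ≤ 4 n`, hence `2 ^ K ≤ 2 √n`.
  have hK1 : n ≤ 4 ^ (Nat.log 4 n + 1) := (Nat.lt_pow_succ_log_self (by norm_num) n).le
  have hK2 : 4 ^ (Nat.log 4 n + 1) ≤ 4 * n := by
    rw [pow_succ, mul_comm]
    exact Nat.mul_le_mul_left 4 (Nat.pow_log_le_self 4 hn.ne')
  have h := hX.integral_dyadicNorm_le (β := euclideanCol B) ha hab hBb
    (sum_inner_euclideanCol_sq_le hB) (by simpa using sum_norm_euclideanCol_sq_le hB)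
    (by simpa using hn) (by simpa using hK1) (by simpa using hK2)
  rw [Fintype.card_fin] at h
  exact (integral_mono (hX.integrable (continuous_norm_mul_of B))
    (hX.integrable (continuous_dyadicNorm _ _)) fun ω => norm_mul_le_dyadicNorm B hK1 (X ω)).trans h

end Matrix

/-! ### Reduction of the theorem to the normalised case. -/

lemma min_one_le_rpow_mul_log {b : ℝ} (hb : 0 ≤ b) {n : ℕ} (hn : 0 < n) :
    min b 1 ≤ 2 * (b ^ (1 / 2 : ℝ) * Real.log (2 * n) ^ (1 / 4 : ℝ)) := by
  have h1 : min b 1 ≤ b ^ (1 / 2 : ℝ) := by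
    have h0 : 0 ≤ min b 1 := le_min hb zero_le_one
    calc min b 1 = min b 1 ^ (1 : ℝ) := (Real.rpow_one _).symm
      _ ≤ min b 1 ^ (1 / 2 : ℝ) :=
          Real.rpow_le_rpow_of_exponent_ge_of_imp h0 (min_le_right _ _) (by norm_num) (by norm_num)
      _ ≤ b ^ (1 / 2 : ℝ) := Real.rpow_le_rpow h0 (min_le_left _ _) (by norm_num)
  have h2 : (1 / 2 : ℝ) ≤ Real.log (2 * n) ^ (1 / 4 : ℝ) := by
    have hn1 : (1 : ℝ) ≤ n := by exact_mod_cast hn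
    have hlog : (1 / 2 : ℝ) ≤ Real.log (2 * n) := by
      have := Real.log_two_gt_d9
      have h3 := Real.log_le_log (by norm_num : (0 : ℝ) < 2) (by linarith : (2 : ℝ) ≤ 2 * n)
      linarith
    calc (1 / 2 : ℝ) = (1 / 2 : ℝ) ^ (1 : ℝ) := (Real.rpow_one _).symm
      _ ≤ (1 / 2 : ℝ) ^ (1 / 4 : ℝ) :=
          Real.rpow_le_rpow_of_exponent_ge (by norm_num) (by norm_num) (by norm_num)
      _ ≤ _ := Real.rpow_le_rpow (by norm_num) hlog (by norm_num)
  have h3 : 0 ≤ b ^ (1 / 2 : ℝ) := Real.rpow_nonneg hb _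
  nlinarith

theorem mainTheorem9 :
    ∃ C : ℝ, 0 < C ∧
      ∀ (N n : ℕ), 0 < N → 0 < n →
      ∀ (a b : ℝ), 0 ≤ a → 0 ≤ b →
      ∀ (Ω : Type*) [MeasurableSpace Ω] (P : Measure Ω) [IsProbabilityMeasure P]
        (A : Ω → Matrix (Fin N) (Fin n) ℝ),
        (∀ i j, Measurable fun ω => A ω i j) →
        iIndepFun (fun (p : Fin N × Fin n) ω => A ω p.1 p.2) P →
        (∀ i j, ∫ ω, A ω i j ∂P = 0) →
        (∀ i j, ∫ ω, (A ω i j) ^ 2 ∂P ≤ 1) →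
        (∀ i j, ∀ᵐ ω ∂P, |A ω i j| ≤ a) →
      ∀ B : Matrix (Fin n) (Fin N) ℝ,
        ‖B‖ ≤ 1 →
        (∀ i, ‖(WithLp.toLp 2 (B.col i) : EuclideanSpace ℝ (Fin n))‖ ≤ b) →
        Integrable (fun ω => ‖B * A ω‖) P ∧
          ∫ ω, ‖B * A ω‖ ∂P
            ≤ C * (1 + a * b ^ (1 / 2 : ℝ) * Real.log (2 * n) ^ (1 / 4 : ℝ)) * √n := by
  -- The bound `1857 (1 + a min(b,1))` and the factor `2` of `min_one_le_rpow_mul_log` require only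
  -- `3714`.
  refine ⟨4000, by norm_num, ?_⟩
  intro N n _ hn a b ha hb Ω _ P _ A hmeas hind hmean hsq hbd B hB hBb
  -- Dividing by `s` gives `(a / s) min(b,1) ≤ 1`, and `s ≥ 1` keeps the variances at most one.
  set s : ℝ := 1 + a * min b 1 with hs
  have hb0 : 0 ≤ min b 1 := le_min hb zero_le_one
  have hs1 : 1 ≤ s := le_add_of_nonneg_right (mul_nonneg ha hb0)
  have hs0 : 0 < s := by linarith
  -- truncation, which changes the entries on a null set only, and rescaling
  set φ : ℝ → ℝ := fun x => s⁻¹ * max (-a) (min a x) with hφ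
  have hφm : Measurable φ := by fun_prop
  have hφeq : ∀ x, |x| ≤ a → φ x = s⁻¹ * x := fun x hx => by
    rw [hφ]
    dsimp only
    rw [min_eq_right (abs_le.1 hx).2, max_eq_right (abs_le.1 hx).1]
  have hae : ∀ i j, ∀ᵐ ω ∂P, φ (A ω i j) = s⁻¹ * A ω i j := fun i j => by
    filter_upwards [hbd i j] with ω hω using hφeq _ hω
  have hX : IsNoise (fun ω (p : Fin N × Fin n) => φ (A ω p.1 p.2)) (s⁻¹ * a) P :=
    { measurable := fun p => hφm.comp (hmeas p.1 p.2)
      indep := hind.comp (fun _ => φ) fun _ => hφm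
      mean := fun p => by
        rw [integral_congr_ae (hae p.1 p.2), integral_const_mul, hmean, mul_zero]
      sq_le := fun p => by
        have h : (fun ω => φ (A ω p.1 p.2) ^ 2) =ᵐ[P] fun ω => (s⁻¹) ^ 2 * A ω p.1 p.2 ^ 2 := by
          filter_upwards [hae p.1 p.2] with ω hω
          rw [hω, mul_pow]
        rw [integral_congr_ae h, integral_const_mul]
        have h1 : (s⁻¹) ^ 2 ≤ 1 := pow_le_one₀ (inv_nonneg.2 hs0.le) (inv_le_one_of_one_le₀ hs1)
        exact mul_le_one₀ h1 (integral_nonneg fun ω => sq_nonneg _) (hsq p.1 p.2)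
      bound := fun ω p => by
        rw [hφ]
        dsimp only
        rw [abs_mul, abs_of_pos (inv_pos.2 hs0)]
        refine mul_le_mul_of_nonneg_left (abs_le.2 ⟨le_max_left _ _, ?_⟩) (inv_pos.2 hs0).le
        exact max_le (by linarith) (min_le_left _ _) }
  have heq : (fun ω => ‖B * A ω‖) =ᵐ[P]
      fun ω => s * ‖B * Matrix.of fun i j => φ (A ω i j)‖ := by
    have hall : ∀ᵐ ω ∂P, ∀ i j, φ (A ω i j) = s⁻¹ * A ω i j :=
      ae_all_iff.2 fun i => ae_all_iff.2 fun j => hae i j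
    filter_upwards [hall] with ω hω
    have h1 : (Matrix.of fun i j => φ (A ω i j)) = s⁻¹ • A ω := by
      ext i j
      simp [hω]
    rw [h1, Matrix.mul_smul, norm_smul, Real.norm_eq_abs, abs_of_pos (inv_pos.2 hs0),
      mul_inv_cancel_left₀ hs0.ne']
  have hint : Integrable (fun ω => ‖B * Matrix.of fun i j => φ (A ω i j)‖) P :=
    hX.integrable (continuous_norm_mul_of B)
  refine ⟨(hint.const_mul s).congr heq.symm, ?_⟩
  rw [integral_congr_ae heq, integral_const_mul]
  have hab : s⁻¹ * a * min b 1 ≤ 1 := by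
    rw [mul_assoc, inv_mul_le_one₀ hs0, hs]
    linarith
  have hmain := hX.integral_norm_mul_le (mul_nonneg (inv_pos.2 hs0).le ha) hab hn hB
    fun i => le_min (hBb i) (norm_euclideanCol_le_one hB i)
  refine (mul_le_mul_of_nonneg_left hmain hs0.le).trans ?_
  have hmin := mul_le_mul_of_nonneg_left (min_one_le_rpow_mul_log hb hn) ha
  rw [← mul_assoc]
  refine mul_le_mul_of_nonneg_right ?_ (Real.sqrt_nonneg _)
  rw [hs, mul_assoc a]
  nlinarith
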